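/- **Conventions.** Let $\Delta$ be the category of finite ordinals $n=\{0,\dots,n-1\}$, $n\ge 0$, and monotone functions. With the ordinal sum $+$ it is a strict monoidal category; regard it as a $2$-category with one $0$-cell $\ast$, with $1$-cells the objects $n$, composition of $1$-cells $n\circ m=n+m$, and $2$-cells the morphisms of $\Delta$. Let $\Pi_r$ be the category whose objects are the same finite ordinals and whose morphisms $n\to m$ are the partial monotone functions $f$ such that, for all $i\le j$ in $n$, if $f(i)$ is defined then so is $f(j)$. Let $W_r:\Delta^{op}\to\mathbf{Cat}$ ($1$-cells reversed) be the $2$-functor given by the right action of $\Delta$ on $\Pi_r$: $W_r(\ast)=\Pi_r$, $W_r(n)=(-)+n$, $W_r(f)=(-)+f$. Let $(\mathcal C,T,\eta,\mu)$ be a monad in a (strict) $2$-category $\mathcal D$, and let $\mathbf T:\Delta\to\mathcal D$ be the corresponding $2$-functor, i.e. the one with $\mathbf T(\ast)=\mathcal C$, $\mathbf T(n)=T^n$, $\mathbf T(0\to 1)=\eta$ and $\mathbf T(2\to 1)=\mu$. A *Kleisli object* of $T$ is a $0$-cell $K$ representing the $2$-functor $\mathcal D\to\mathbf{Cat}$ that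 sends $X$ to the category of colax monad morphisms from $T$ to the identity monad on $X$: the objects are the pairs $(U:\mathcal C\to X,\ \xi:UT\to U)$ with $\xi\circ U\eta=1_U$ and $\xi\circ \xi_T=\xi\circ U\mu$, and the morphisms $(U,\xi)\to(U',\xi')$ are the $2$-cells $\tau:U\to U'$ with $\tau\circ\xi=\xi'\circ\tau_T$. A *$W_r$-weighted colimit* of $\mathbf T$ is a $0$-cell $L$ representing the $2$-functor $\mathcal D\to\mathbf{Cat}$ that sends $X$ to the category of $2$-natural transformations $W_r\to\mathcal D(\mathbf T(-),X)$ and modifications. Here $K$ represents $G:\mathcal D\to\mathbf{Cat}$ if there is a $2$-natural isomorphism $\mathcal D(K,-)\cong G$. **Theorem.** The monad $T$ admits a Kleisli object if and only if $\mathbf T$ has a $W_r$-weighted colimit. If this is the case, then the Kleisli object of $T$ and the $W_r$-weighted colimit of $\mathbf T$ are isomorphic in $\mathcal D$. -/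

import Mathlib

open CategoryTheory Bicategory Opposite

universe w v u w₁ v₁ u₁ v₂ u₂ v₃ u₃

namespace KleisliWeight

attribute [-instance] CategoryTheory.instCategoryEndMonoidal

/-! ### The simplicial category and its strict monoidal structure -/

/-- Objects of the (algebraists') simplicial category `Δ`: the finite ordinals
`n = {0, …, n - 1}`, including the empty one. -/
structure Delta where
  len : ℕ

namespace Delta

/-- Morphisms of `Δ` are the monotone functions. -/
instance : Category Delta where
  Hom n m := Fin n.len →o Fin m.len
  id _ := OrderHom.id
  comp f g := g.comp f

/-- The monotone function underlying a morphism of `Δ`. -/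
def fn {n m : Delta} (f : n ⟶ m) : Fin n.len →o Fin m.len := f

/-- The values of a morphism of `Δ` as natural numbers, extended by `0`. -/
def val {n m : Delta} (f : n ⟶ m) (x : ℕ) : ℕ := if h : x < n.len then (fn f ⟨x, h⟩).val else 0

lemma hom_ext {n m : Delta} {f g : n ⟶ m} (h : ∀ x < n.len, val f x = val g x) : f = g := by
  refine OrderHom.ext _ _ (funext fun i => Fin.ext ?_)
  have hi := h i.val i.isLt
  rw [val, val, dif_pos i.isLt, dif_pos i.isLt] at hi
  exact hi

lemma val_lt {n m : Delta} (f : n ⟶ m) {x : ℕ} (h : x < n.len) : val f x < m.len := by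
  rw [val, dif_pos h]; exact Fin.isLt _

lemma val_id {n : Delta} {x : ℕ} (h : x < n.len) : val (𝟙 n) x = x := by
  rw [val, dif_pos h]; rfl

lemma val_comp {n m k : Delta} (f : n ⟶ m) (g : m ⟶ k) {x : ℕ} (h : x < n.len) :
    val (f ≫ g) x = val g (val f x) := by
  rw [val, val, dif_pos h, dif_pos (val_lt f h)]
  simp only [val, dif_pos h]
  rfl

lemma val_eqToHom {n m : Delta} (e : n = m) {x : ℕ} (h : x < n.len) :
    val (eqToHom e) x = x := by
  subst e; exact val_id h

/-- The ordinal sum `n + m` of objects of `Δ`. -/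
def add (n m : Delta) : Delta := ⟨n.len + m.len⟩

lemma add_len (n m : Delta) : (add n m).len = n.len + m.len := rfl

/-- The ordinal sum `f + g` of monotone functions: `f` on the first summand, `g` on the second. -/
def sumFn {a b c d : ℕ} (f : Fin a →o Fin c) (g : Fin b →o Fin d) :
    Fin (a + b) →o Fin (c + d) where
  toFun i :=
    if h : i.val < a then Fin.castAdd d (f ⟨i.val, h⟩)
    else Fin.natAdd c (g ⟨i.val - a, by have := i.isLt; omega⟩)
  monotone' i j hij := by
    have hij' : i.val ≤ j.val := hij
    by_cases h₁ : i.val < a <;> by_cases h₂ : j.val < a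
    · simp only [dif_pos h₁, dif_pos h₂]
      exact f.monotone (show (⟨i.val, h₁⟩ : Fin a) ≤ ⟨j.val, h₂⟩ from hij')
    · simp only [dif_pos h₁, dif_neg h₂, Fin.le_def, Fin.val_castAdd, Fin.val_natAdd]; omega
    · omega
    · simp only [dif_neg h₁, dif_neg h₂, Fin.le_def, Fin.val_natAdd, add_le_add_iff_left]
      exact g.monotone (show (⟨i.val - a, _⟩ : Fin b) ≤ ⟨j.val - a, _⟩ from by
        simp only [Fin.le_def]; omega)

/-- The ordinal sum `f + g` of morphisms of `Δ`. -/
def sum {n m n' m' : Delta} (f : n ⟶ n') (g : m ⟶ m') : add n m ⟶ add n' m' :=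
  sumFn (fn f) (fn g)

lemma val_sum {n m n' m' : Delta} (f : n ⟶ n') (g : m ⟶ m') {x : ℕ}
    (h : x < n.len + m.len) :
    val (sum f g) x = if x < n.len then val f x else n'.len + val g (x - n.len) := by
  rw [val, dif_pos (show x < (add n m).len from h)]
  change (dite _ _ _ : Fin (n'.len + m'.len)).val = _
  by_cases h₁ : x < n.len
  · rw [dif_pos h₁, if_pos h₁, val, dif_pos h₁]; rfl
  · rw [dif_neg h₁, if_neg h₁, val, dif_pos (by omega)]; rfl

lemma add_assoc' (n m k : Delta) : add (add n m) k = add n (add m k) := by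
  simp only [add, add_assoc]

lemma add_zero' (n : Delta) : add n ⟨0⟩ = n := rfl

lemma zero_add' (n : Delta) : add ⟨0⟩ n = n := by
  cases n; simp only [add, zero_add]

lemma sum_id (n m : Delta) : sum (𝟙 n) (𝟙 m) = 𝟙 (add n m) := by
  apply hom_ext
  intro x hx
  have hx' : x < n.len + m.len := hx
  rw [val_sum _ _ hx', val_id hx]
  split_ifs with h
  · exact val_id h
  · rw [val_id (by omega)]; omega

lemma sum_comp {n m k n' m' k' : Delta} (f : n ⟶ m) (g : m ⟶ k) (f' : n' ⟶ m') (g' : m' ⟶ k') :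
    sum (f ≫ g) (f' ≫ g') = sum f f' ≫ sum g g' := by
  apply hom_ext
  intro x hx
  have hx' : x < n.len + n'.len := hx
  have hy : val (sum f f') x < m.len + m'.len := val_lt (sum f f') hx
  rw [val_comp _ _ hx, val_sum _ _ hx', val_sum _ _ hy, val_sum _ _ hx']
  by_cases h : x < n.len
  · rw [if_pos h, if_pos h, if_pos (val_lt f h), val_comp _ _ h]
  · rw [if_neg h, if_neg h, if_neg (by omega), val_comp _ _ (by omega), Nat.add_sub_cancel_left]

lemma sum_assoc {n m k n' m' k' : Delta} (f : n ⟶ n') (g : m ⟶ m') (h : k ⟶ k') :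
    sum (sum f g) h =
      eqToHom (add_assoc' n m k) ≫ sum f (sum g h) ≫ eqToHom (add_assoc' n' m' k').symm := by
  apply hom_ext
  intro x hx
  have hx₁ : x < (add n m).len + k.len := hx
  have hx₂ : x < (add n (add m k)).len := by simp only [add] at hx ⊢; omega
  rw [val_comp _ _ hx, val_eqToHom _ hx, val_comp _ _ hx₂, val_eqToHom _ (val_lt _ hx₂),
    val_sum _ _ hx₁, val_sum _ _ hx₂]
  rw [add_len] at hx₁ hx₂
  rw [add_len] at hx₂
  have e₁ := add_len n m
  have e₂ := add_len n' m'
  by_cases h₁ : x < n.len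
  · rw [if_pos h₁, if_pos (by omega), val_sum f g (by omega), if_pos h₁]
  · rw [if_neg h₁, val_sum g h (by omega)]
    by_cases h₂ : x < (add n m).len
    · rw [if_pos h₂, if_pos (by omega), val_sum _ _ h₂, if_neg h₁]
    · rw [if_neg h₂, if_neg (by omega), Nat.sub_sub, e₁, e₂, add_assoc]

lemma sum_zero {n n' : Delta} (f : n ⟶ n') : sum f (𝟙 (⟨0⟩ : Delta)) = f := by
  apply hom_ext
  intro x hx
  rw [val_sum _ _ hx]
  exact if_pos hx

lemma zero_sum {n n' : Delta} (f : n ⟶ n') :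
    sum (𝟙 (⟨0⟩ : Delta)) f = eqToHom (zero_add' n) ≫ f ≫ eqToHom (zero_add' n').symm := by
  apply hom_ext
  intro x hx
  have hx' : x < n.len := by simpa only [add, zero_add] using hx
  rw [val_sum _ _ hx, val_comp _ _ hx, val_eqToHom _ hx, val_comp _ _ hx',
    val_eqToHom _ (val_lt f hx')]
  simp

lemma sum_eqToHom_id {n n' : Delta} (e : n = n') (m : Delta) :
    sum (eqToHom e) (𝟙 m) = eqToHom (by rw [e]) := by
  subst e; simp [sum_id]

lemma sum_id_eqToHom (n : Delta) {m m' : Delta} (e : m = m') :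
    sum (𝟙 n) (eqToHom e) = eqToHom (by rw [e]) := by
  subst e; simp [sum_id]

end Delta

/-- The one-object `2`-category of the strict monoidal category `Δ`: a single `0`-cell `*`, the
`1`-cells are the objects of `Δ`, the `2`-cells are the morphisms of `Δ`, and the composite
`n ∘ m` of `1`-cells is the ordinal sum `n + m`. -/
inductive BDelta : Type
  | star

namespace BDelta

open Delta

/-- Mathlib writes compositions in diagrammatic order, so `m ≫ n = n ∘ m` is `n + m`. -/
instance : Bicategory BDelta where
  Hom _ _ := Delta
  id _ := ⟨0⟩
  comp m n := add n m
  homCategory _ _ := inferInstanceAs (Category Delta)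
  whiskerLeft m _ _ f := sum f (𝟙 m)
  whiskerRight f n := sum (𝟙 n) f
  associator k m n := eqToIso (add_assoc' n m k).symm
  leftUnitor n := eqToIso (add_zero' n)
  rightUnitor n := eqToIso (zero_add' n)
  whiskerLeft_id m n := sum_id n m
  whiskerLeft_comp m _ _ _ f g := by rw [← sum_comp, Category.comp_id]
  id_whiskerLeft f := by
    rw [eqToIso.hom, eqToIso.inv]
    exact sum_zero f
  comp_whiskerLeft m n _ _ f := by
    rw [← sum_id, eqToIso.hom, eqToIso.inv, sum_assoc]
    simp
  id_whiskerRight m n := sum_id n m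
  comp_whiskerRight f g n := by rw [← sum_comp, Category.comp_id]
  whiskerRight_id f := by
    rw [eqToIso.hom, eqToIso.inv]
    exact zero_sum f
  whiskerRight_comp f m n := by
    rw [← sum_id, eqToIso.hom, eqToIso.inv, sum_assoc]
  whisker_assoc m _ _ f n := by
    rw [eqToIso.hom, eqToIso.inv, sum_assoc]
    simp
  whisker_exchange f g := by
    rw [← sum_comp, ← sum_comp]
    simp only [Category.comp_id, Category.id_comp]
  pentagon _ _ _ _ := by simp [sum_eqToHom_id, sum_id_eqToHom]
  triangle _ _ := by simp [sum_eqToHom_id, sum_id_eqToHom]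

instance : Bicategory.Strict BDelta where
  id_comp n := add_zero' n
  comp_id n := zero_add' n
  assoc k m n := (add_assoc' n m k).symm

end BDelta

/-! ### The partial simplicial categories -/

/-- Partial monotone functions from `n = {0, …, n - 1}` to `m = {0, …, m - 1}`; the value `none`
means "undefined". -/
structure PartialMono (n m : ℕ) where
  toFun : Fin n → Option (Fin m)
  mono : ∀ i j a b, i ≤ j → toFun i = some a → toFun j = some b → a ≤ b

namespace PartialMono

@[ext] lemma ext {n m : ℕ} {f g : PartialMono n m} (h : f.toFun = g.toFun) : f = g := by
  cases f; cases g; cases h; rfl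

/-- A total monotone function as a partial one. -/
def ofTotal {n m : ℕ} (f : Fin n →o Fin m) : PartialMono n m where
  toFun i := some (f i)
  mono i j a b hij ha hb := by
    cases ha; cases hb; exact f.monotone hij

/-- Composition of partial monotone functions: `g ∘ f` is defined at `i` iff `f` is defined at `i`
and `g` is defined at `f i`. -/
def comp {n m k : ℕ} (f : PartialMono n m) (g : PartialMono m k) : PartialMono n k where
  toFun i := (f.toFun i).bind g.toFun
  mono i j a b hij ha hb := by
    obtain ⟨a', ha', ha⟩ := Option.bind_eq_some_iff.1 ha
    obtain ⟨b', hb', hb⟩ := Option.bind_eq_some_iff.1 hb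
    exact g.mono _ _ _ _ (f.mono _ _ _ _ hij ha' hb') ha hb

/-- The ordinal sum of partial monotone functions. -/
def sum {a b c d : ℕ} (f : PartialMono a c) (g : PartialMono b d) :
    PartialMono (a + b) (c + d) where
  toFun i :=
    if h : i.val < a then (f.toFun ⟨i.val, h⟩).map (Fin.castAdd d)
    else (g.toFun ⟨i.val - a, by have := i.isLt; omega⟩).map (Fin.natAdd c)
  mono i j x y hij hx hy := by
    have hij' : i.val ≤ j.val := hij
    by_cases h₁ : i.val < a <;> by_cases h₂ : j.val < a
    · rw [dif_pos h₁] at hx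
      rw [dif_pos h₂] at hy
      obtain ⟨x', hx', rfl⟩ := Option.map_eq_some_iff.1 hx
      obtain ⟨y', hy', rfl⟩ := Option.map_eq_some_iff.1 hy
      exact f.mono _ _ _ _ (show (⟨i.val, h₁⟩ : Fin a) ≤ ⟨j.val, h₂⟩ from hij') hx' hy'
    · rw [dif_pos h₁] at hx
      rw [dif_neg h₂] at hy
      obtain ⟨x', hx', rfl⟩ := Option.map_eq_some_iff.1 hx
      obtain ⟨y', hy', rfl⟩ := Option.map_eq_some_iff.1 hy
      simp only [Fin.le_def, Fin.val_castAdd, Fin.val_natAdd]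
      omega
    · omega
    · rw [dif_neg h₁] at hx
      rw [dif_neg h₂] at hy
      obtain ⟨x', hx', rfl⟩ := Option.map_eq_some_iff.1 hx
      obtain ⟨y', hy', rfl⟩ := Option.map_eq_some_iff.1 hy
      have := g.mono _ _ _ _ (show (⟨i.val - a, _⟩ : Fin b) ≤ ⟨j.val - a, _⟩ from by
        simp only [Fin.le_def]; omega) hx' hy'
      simp only [Fin.le_def, Fin.val_natAdd] at this ⊢
      omega

/-- The domain of definition is closed upwards: if `f i` is defined and `i ≤ j`, then `f j` is
defined. -/
def DomUpClosed {n m : ℕ} (f : PartialMono n m) : Prop :=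
  ∀ i j, i ≤ j → (f.toFun i).isSome → (f.toFun j).isSome

end PartialMono

/-- Objects of the partial simplicial category `Π`: the same as those of `Δ`. -/
structure PiCat where
  len : ℕ

/-- The partial simplicial category `Π`: finite ordinals and partial monotone functions. -/
instance : Category PiCat where
  Hom n m := PartialMono n.len m.len
  id _ := PartialMono.ofTotal OrderHom.id
  comp f g := f.comp g
  id_comp f := by
    ext i : 2; rfl
  comp_id f := by
    ext i : 2
    change (f.toFun i).bind some = _
    simp
  assoc f g h := by
    ext i : 2
    exact Option.bind_assoc _ _ _

/-- Objects of the right partial simplicial category `Π_r`: the same as those of `Π`. -/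
structure PiR where
  toPi : PiCat

namespace PiR

/-- Morphisms of `Π_r`: the morphisms of `Π` whose domain of definition is closed upwards. -/
instance : Category PiR where
  Hom n m := { f : n.toPi ⟶ m.toPi // PartialMono.DomUpClosed f }
  id n := ⟨𝟙 n.toPi, fun _ _ _ _ => rfl⟩
  comp f g := ⟨f.1 ≫ g.1, by
    intro i j hij hi
    obtain ⟨c, hc⟩ := Option.isSome_iff_exists.1 hi
    obtain ⟨a, ha, hc⟩ := Option.bind_eq_some_iff.1 hc
    obtain ⟨b, hb⟩ := Option.isSome_iff_exists.1 (f.2 i j hij (by rw [ha]; rfl))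
    have := g.2 a b (f.1.mono _ _ _ _ hij ha hb) (by rw [hc]; rfl)
    change ((f.1.toFun j).bind g.1.toFun).isSome
    rw [hb]
    exact this⟩
  id_comp f := Subtype.ext (Category.id_comp f.1)
  comp_id f := Subtype.ext (Category.comp_id f.1)
  assoc f g h := Subtype.ext (Category.assoc f.1 g.1 h.1)

/-- The number of elements of an object of `Π_r`. -/
abbrev len (n : PiR) : ℕ := n.toPi.len

/-- The values of a morphism of `Π_r` as natural numbers. -/
def val {n m : PiR} (f : n ⟶ m) (x : ℕ) : Option ℕ :=
  if h : x < n.len then (f.1.toFun ⟨x, h⟩).map Fin.val else none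

lemma hom_ext {n m : PiR} {f g : n ⟶ m} (h : ∀ x < n.len, val f x = val g x) : f = g := by
  refine Subtype.ext (PartialMono.ext (funext fun i => ?_))
  have hi := h i.val i.isLt
  rw [val, val, dif_pos i.isLt, dif_pos i.isLt] at hi
  exact Option.map_injective Fin.val_injective hi

lemma val_lt {n m : PiR} (f : n ⟶ m) {x y : ℕ} (h : val f x = some y) : y < m.len := by
  by_cases hx : x < n.len
  · rw [val, dif_pos hx] at h
    obtain ⟨z, -, rfl⟩ := Option.map_eq_some_iff.1 h
    exact z.isLt
  · rw [val, dif_neg hx] at h; cases h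

lemma val_id {n : PiR} {x : ℕ} (h : x < n.len) : val (𝟙 n) x = some x := by
  rw [val, dif_pos h]; rfl

lemma val_comp {n m k : PiR} (f : n ⟶ m) (g : m ⟶ k) (x : ℕ) :
    val (f ≫ g) x = (val f x).bind (val g) := by
  by_cases h : x < n.len
  · simp only [val, dif_pos h]
    change ((f.1.toFun ⟨x, h⟩).bind g.1.toFun).map Fin.val = _
    cases f.1.toFun ⟨x, h⟩ with
    | none => rfl
    | some y =>
      change _ = val g y.val
      rw [val, dif_pos y.isLt]
      rfl
  · simp only [val, dif_neg h]; rfl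

lemma val_eqToHom {n m : PiR} (e : n = m) {x : ℕ} (h : x < n.len) :
    val (eqToHom e) x = some x := by
  subst e; exact val_id h

/-- The object `k + n` of `Π_r`, for `k` in `Π_r` and `n` in `Δ`. -/
def add (k : PiR) (n : Delta) : PiR := ⟨⟨k.len + n.len⟩⟩

lemma add_len (k : PiR) (n : Delta) : (add k n).len = k.len + n.len := rfl

/-- The morphism `g + f` of `Π_r`, for `g` in `Π_r` and `f` in `Δ`. -/
def sum {k l : PiR} {n m : Delta} (g : k ⟶ l) (f : n ⟶ m) : add k n ⟶ add l m :=
  ⟨PartialMono.sum g.1 (PartialMono.ofTotal (Delta.fn f)), by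
    intro i j hij hi
    have hij' : i.val ≤ j.val := hij
    change (dite _ _ _ : Option (Fin (l.len + m.len))).isSome at hi
    change (dite _ _ _ : Option (Fin (l.len + m.len))).isSome
    by_cases h₂ : j.val < k.len
    · have h₁ : i.val < k.len := by omega
      rw [dif_pos h₁, Option.isSome_map] at hi
      rw [dif_pos h₂, Option.isSome_map]
      exact g.2 _ _ (show (⟨i.val, h₁⟩ : Fin k.len) ≤ ⟨j.val, h₂⟩ from hij') hi
    · rw [dif_neg h₂, Option.isSome_map]; rfl⟩

lemma val_sum {k l : PiR} {n m : Delta} (g : k ⟶ l) (f : n ⟶ m) {x : ℕ}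
    (h : x < k.len + n.len) :
    val (sum g f) x =
      if x < k.len then val g x else some (l.len + Delta.val f (x - k.len)) := by
  rw [val, dif_pos (show x < (add k n).len from h)]
  change (dite _ _ _ : Option (Fin (l.len + m.len))).map _ = _
  by_cases h₁ : x < k.len
  · rw [dif_pos h₁, if_pos h₁, val, dif_pos h₁]
    cases g.1.toFun ⟨x, h₁⟩ <;> rfl
  · rw [dif_neg h₁, if_neg h₁, Delta.val, dif_pos (by omega)]; rfl

lemma sum_id (k : PiR) (n : Delta) : sum (𝟙 k) (𝟙 n) = 𝟙 (add k n) := by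
  apply hom_ext
  intro x hx
  have hx' : x < k.len + n.len := hx
  rw [val_sum _ _ hx', val_id hx]
  split_ifs with h
  · exact val_id h
  · rw [Delta.val_id (by omega)]; congr 1; omega

lemma sum_comp {k l p : PiR} {n m q : Delta} (g : k ⟶ l) (g' : l ⟶ p) (f : n ⟶ m) (f' : m ⟶ q) :
    sum (g ≫ g') (f ≫ f') = sum g f ≫ sum g' f' := by
  apply hom_ext
  intro x hx
  have hx' : x < k.len + n.len := hx
  rw [val_comp, val_sum _ _ hx', val_sum _ _ hx']
  by_cases h : x < k.len
  · rw [if_pos h, if_pos h, val_comp]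
    cases e : val g x with
    | none => rfl
    | some y =>
      have hy := val_lt g e
      change _ = val (sum g' f') y
      rw [val_sum _ _ (by omega), if_pos hy]; rfl
  · have hy := Delta.val_lt f (show x - k.len < n.len by omega)
    rw [if_neg h, if_neg h]
    change _ = val (sum g' f') _
    rw [val_sum _ _ (by omega), if_neg (by omega), Delta.val_comp _ _ (by omega),
      Nat.add_sub_cancel_left]

lemma add_assoc' (k : PiR) (n m : Delta) : add (add k n) m = add k (Delta.add n m) := by
  simp only [add, Delta.add, len, add_assoc]

lemma add_zero' (k : PiR) : add k ⟨0⟩ = k := rfl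

lemma sum_assoc {k k' : PiR} {n m n' m' : Delta} (g : k ⟶ k') (f : n ⟶ n') (h : m ⟶ m') :
    sum (sum g f) h =
      eqToHom (add_assoc' k n m) ≫ sum g (Delta.sum f h) ≫
        eqToHom (add_assoc' k' n' m').symm := by
  have key : sum (sum g f) h ≫ eqToHom (add_assoc' k' n' m') =
      eqToHom (add_assoc' k n m) ≫ sum g (Delta.sum f h) := by
    apply hom_ext
    intro x hx
    have hx₁ : x < (add k n).len + m.len := hx
    have hx₂ : x < k.len + (Delta.add n m).len := by
      rw [add_len] at hx₁; rw [Delta.add_len]; omega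
    rw [val_comp, val_comp, val_eqToHom _ hx]
    change _ = val (sum g _) x
    have e₁ := add_len k n
    have e₂ := add_len k' n'
    have e₃ := Delta.add_len n m
    have hr : (val (sum (sum g f) h) x).bind (val (eqToHom (add_assoc' k' n' m'))) =
        val (sum (sum g f) h) x := by
      cases e : val (sum (sum g f) h) x with
      | none => rfl
      | some y => exact val_eqToHom _ (val_lt _ e)
    rw [hr, val_sum _ _ hx₁, val_sum _ _ hx₂]
    by_cases h₁ : x < k.len
    · rw [if_pos h₁, if_pos (by omega), val_sum g f (by omega), if_pos h₁]
    · rw [if_neg h₁, Delta.val_sum f h (by omega)]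
      by_cases h₂ : x < (add k n).len
      · rw [if_pos h₂, if_pos (by omega), val_sum _ _ h₂, if_neg h₁]
      · rw [if_neg h₂, if_neg (by omega), Nat.sub_sub, e₁, e₂, add_assoc]
  rw [← Category.assoc, ← key]
  simp

lemma sum_zero {k k' : PiR} (g : k ⟶ k') : sum g (𝟙 (⟨0⟩ : Delta)) = g := by
  apply hom_ext
  intro x hx
  rw [val_sum _ _ hx]
  exact if_pos hx

/-- The functor `(-) + n : Π_r ⥤ Π_r`. -/
def addRight (n : Delta) : PiR ⥤ PiR where
  obj k := add k n
  map g := sum g (𝟙 n)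
  map_id k := sum_id k n
  map_comp g g' := by rw [← sum_comp, Category.comp_id]

/-- The natural transformation `(-) + f`. -/
def addRightMap {n m : Delta} (f : n ⟶ m) : addRight n ⟶ addRight m where
  app k := sum (𝟙 k) f
  naturality k l g := by
    change sum _ _ ≫ sum _ _ = sum _ _ ≫ sum _ _
    rw [← sum_comp, ← sum_comp]
    simp only [Category.comp_id, Category.id_comp]

end PiR

lemma unop2_eqToHom {B : Type u} [Bicategory.{w, v} B] {a b : Bᵒᵖ} {f g : a ⟶ b} (h : f = g) :
    (eqToHom h).unop2 = eqToHom (congrArg Quiver.Hom.unop h) := by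
  subst h; rfl

lemma hom2_ext {B : Type u} [Bicategory.{w, v} B] {a b : Bᵒᵖ} {f g : a ⟶ b} {α β : f ⟶ g}
    (h : α.unop2 = β.unop2) : α = β :=
  congrArg Bicategory.Opposite.Hom2.op2' h

/-- The `1`-cell dual of a strict `2`-category is strict. -/
instance opStrict (B : Type u) [Bicategory.{w, v} B] [Bicategory.Strict B] :
    Bicategory.Strict Bᵒᵖ where
  id_comp f := Quiver.Hom.unop_inj (Bicategory.Strict.comp_id f.unop)
  comp_id f := Quiver.Hom.unop_inj (Bicategory.Strict.id_comp f.unop)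
  assoc f g h := Quiver.Hom.unop_inj (Bicategory.Strict.assoc h.unop g.unop f.unop).symm
  leftUnitor_eqToIso f := by
    apply Iso.ext
    apply hom2_ext
    rw [eqToIso.hom, unop2_eqToHom]
    change (ρ_ f.unop).hom = _
    rw [Bicategory.Strict.rightUnitor_eqToIso]; rfl
  rightUnitor_eqToIso f := by
    apply Iso.ext
    apply hom2_ext
    rw [eqToIso.hom, unop2_eqToHom]
    change (λ_ f.unop).hom = _
    rw [Bicategory.Strict.leftUnitor_eqToIso]; rfl
  associator_eqToIso f g h := by
    apply Iso.ext
    apply hom2_ext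
    rw [eqToIso.hom, unop2_eqToHom]
    change (α_ h.unop g.unop f.unop).inv = _
    rw [Bicategory.Strict.associator_eqToIso]; rfl

namespace PiR

lemma sum_assoc' {k k' : PiR} {n m n' m' : Delta} (g : k ⟶ k') (f : n ⟶ n') (h : m ⟶ m') :
    sum g (Delta.sum f h) =
      eqToHom (add_assoc' k n m).symm ≫ sum (sum g f) h ≫ eqToHom (add_assoc' k' n' m') := by
  rw [sum_assoc]
  simp only [Category.assoc, eqToHom_trans, eqToHom_refl, Category.comp_id, eqToHom_trans_assoc,
    Category.id_comp]

lemma sum_id_sum (k : PiR) (n : Delta) {m m' : Delta} (f : m ⟶ m') :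
    sum (𝟙 k) (Delta.sum (𝟙 n) f) =
      eqToHom (add_assoc' k n m).symm ≫ sum (𝟙 (add k n)) f ≫ eqToHom (add_assoc' k n m') := by
  rw [sum_assoc', sum_id]

lemma sum_id_comp (k : PiR) {n m q : Delta} (f : n ⟶ m) (g : m ⟶ q) :
    sum (𝟙 k) (f ≫ g) = sum (𝟙 k) f ≫ sum (𝟙 k) g := by
  rw [← sum_comp, Category.comp_id]

lemma addRight_zero : addRight ⟨0⟩ = 𝟭 PiR :=
  _root_.CategoryTheory.Functor.ext (fun k => add_zero' k) fun _ _ g =>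
    (sum_zero g).trans ((Category.id_comp _).trans (Category.comp_id _)).symm

lemma addRight_add (n m : Delta) : addRight (Delta.add n m) = addRight n ⋙ addRight m :=
  _root_.CategoryTheory.Functor.ext (fun k => (add_assoc' k n m).symm) fun _ _ g => by
    have := sum_assoc' g (𝟙 n) (𝟙 m)
    rw [Delta.sum_id] at this
    exact this

end PiR

/-- The weight `W_r`, the action of `Δ` on `Π_r` by ordinal sum on the right:
`W_r(*) = Π_r`, `W_r(n) = (-) + n`, `W_r(f) = (-) + f`. Since `W_r(n ∘ m) = (-) + n + m` is
`W_r(m) ∘ W_r(n)`, it reverses the composition of `1`-cells, as a weight for colimits has to. -/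
def Wr : StrictPseudofunctor BDeltaᵒᵖ Cat.{0, 0} := StrictPseudofunctor.mk''
  { obj := fun _ => Cat.of PiR
    map := fun n => (PiR.addRight n.unop).toCatHom
    map₂ := fun f => (PiR.addRightMap f.unop2).toCatHom₂
    map₂_id := fun n => by
      ext k : 3
      exact PiR.sum_id k n.unop
    map₂_comp := fun f g => by
      ext k : 3
      exact PiR.sum_id_comp k f.unop2 g.unop2
    map_id := fun _ => congrArg Functor.toCatHom PiR.addRight_zero
    map_comp := fun n m => congrArg Functor.toCatHom (PiR.addRight_add n.unop m.unop)
    map₂_whisker_left := fun n m m' f => by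
      ext k : 3
      simp only [Cat.Hom₂.comp_app, Cat.eqToHom_app]
      exact PiR.sum_id_sum k n.unop f.unop2
    map₂_whisker_right := fun f m => by
      ext k : 3
      simp only [Cat.Hom₂.comp_app, Cat.eqToHom_app]
      exact PiR.sum_assoc' (𝟙 (k : PiR)) f.unop2 (𝟙 m.unop) }

/-! ### Strict `2`-natural transformations, modifications, representability -/

section TwoNatural

variable {J : Type u₁} [Bicategory.{w₁, v₁} J]

/-- (Strict) `2`-natural transformations between `2`-functors with values in categories. The two
`2`-functors may take values in categories of different sizes. -/
structure TwoNatTrans (F : StrictPseudofunctor J Cat.{v₂, u₂})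
    (G : StrictPseudofunctor J Cat.{v₃, u₃}) where
  /-- the components -/
  app (j : J) : F.obj j ⥤ G.obj j
  /-- naturality with respect to `1`-cells -/
  naturality {i j : J} (f : i ⟶ j) :
    (F.map f).toFunctor ⋙ app j = app i ⋙ (G.map f).toFunctor
  /-- naturality with respect to `2`-cells; the `eqToHom`s identify the two sides of
  `naturality` -/
  naturality₂ {i j : J} {f g : i ⟶ j} (α : f ⟶ g) (x : F.obj i) :
    (app j).map ((F.map₂ α).toNatTrans.app x) =
      eqToHom (Functor.congr_obj (naturality f) x) ≫
        (G.map₂ α).toNatTrans.app ((app i).obj x) ≫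
          eqToHom (Functor.congr_obj (naturality g) x).symm

namespace TwoNatTrans

variable {F : StrictPseudofunctor J Cat.{v₂, u₂}} {G : StrictPseudofunctor J Cat.{v₃, u₃}}

/-- Modifications between `2`-natural transformations. -/
@[ext]
structure Modification (l l' : TwoNatTrans F G) where
  /-- the components -/
  app (j : J) : l.app j ⟶ l'.app j
  /-- compatibility with `1`-cells; the `eqToHom`s come from the naturality of `l` and `l'` -/
  naturality {i j : J} (f : i ⟶ j) (x : F.obj i) :
    (app j).app ((F.map f).toFunctor.obj x) =
      eqToHom (Functor.congr_obj (l.naturality f) x) ≫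
        (G.map f).toFunctor.map ((app i).app x) ≫
          eqToHom (Functor.congr_obj (l'.naturality f) x).symm

/-- The category of `2`-natural transformations and modifications. -/
instance : Category (TwoNatTrans F G) where
  Hom := Modification
  id l :=
    { app := fun j => 𝟙 (l.app j)
      naturality := fun f x => by simp }
  comp m m' :=
    { app := fun j => m.app j ≫ m'.app j
      naturality := fun f x => by
        simp only [NatTrans.comp_app, m.naturality, m'.naturality, Functor.map_comp,
          Category.assoc, eqToHom_trans_assoc, eqToHom_refl, Category.id_comp] }

@[ext] lemma hom_ext {l l' : TwoNatTrans F G} {m m' : l ⟶ l'}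
    (h : ∀ j x, (m.app j).app x = (m'.app j).app x) : m = m' :=
  Modification.ext (funext fun j => NatTrans.ext (funext fun x => h j x))

@[simp] lemma id_app (l : TwoNatTrans F G) (j : J) : Modification.app (𝟙 l) j = 𝟙 (l.app j) := rfl

@[simp] lemma comp_app {l l' l'' : TwoNatTrans F G} (m : l ⟶ l') (m' : l' ⟶ l'') (j : J) :
    Modification.app (m ≫ m') j = m.app j ≫ m'.app j := rfl

lemma ext' {l l' : TwoNatTrans F G} (h : ∀ j, l.app j = l'.app j) : l = l' := by
  cases l; cases l'
  obtain rfl := funext h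
  rfl

lemma eq_conj {l₁ l₂ l₃ l₄ : TwoNatTrans F G} (m : l₁ ⟶ l₄) (e : l₁ = l₂) (m' : l₂ ⟶ l₃)
    (e' : l₃ = l₄)
    (h : ∀ j x, (m.app j).app x =
      eqToHom (by rw [e]) ≫ (m'.app j).app x ≫ eqToHom (by rw [e'])) :
    m = eqToHom e ≫ m' ≫ eqToHom e' := by
  subst e e'
  apply hom_ext
  intro j x
  rw [h]
  simp

end TwoNatTrans

/-- A `2`-natural isomorphism: a `2`-natural transformation each of whose components is an
isomorphism of categories. -/
structure TwoNatIso (F : StrictPseudofunctor J Cat.{v₂, u₂})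
    (G : StrictPseudofunctor J Cat.{v₃, u₃}) extends TwoNatTrans F G where
  /-- the inverses of the components -/
  inv (j : J) : G.obj j ⥤ F.obj j
  app_inv (j : J) : app j ⋙ inv j = 𝟭 _
  inv_app (j : J) : inv j ⋙ app j = 𝟭 _

end TwoNatural

section Representable

variable {D : Type u} [Bicategory.{w, v} D] [Bicategory.Strict D]

lemma id_whiskerLeft' {a b : D} {f g : a ⟶ b} (η : f ⟶ g) :
    𝟙 a ◁ η = eqToHom (Bicategory.Strict.id_comp f) ≫ η ≫
      eqToHom (Bicategory.Strict.id_comp g).symm := by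
  simp [Bicategory.Strict.leftUnitor_eqToIso]

lemma whiskerRight_id' {a b : D} {f g : a ⟶ b} (η : f ⟶ g) :
    η ▷ 𝟙 b = eqToHom (Bicategory.Strict.comp_id f) ≫ η ≫
      eqToHom (Bicategory.Strict.comp_id g).symm := by
  simp [Bicategory.Strict.rightUnitor_eqToIso]

lemma comp_whiskerLeft' {a b c d : D} (f : a ⟶ b) (g : b ⟶ c) {h h' : c ⟶ d} (η : h ⟶ h') :
    (f ≫ g) ◁ η = eqToHom (Bicategory.Strict.assoc f g h) ≫ f ◁ g ◁ η ≫
      eqToHom (Bicategory.Strict.assoc f g h').symm := by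
  simp [Bicategory.Strict.associator_eqToIso]

lemma whiskerRight_comp' {a b c d : D} {f f' : a ⟶ b} (η : f ⟶ f') (g : b ⟶ c) (h : c ⟶ d) :
    η ▷ (g ≫ h) = eqToHom (Bicategory.Strict.assoc f g h).symm ≫ η ▷ g ▷ h ≫
      eqToHom (Bicategory.Strict.assoc f' g h) := by
  simp [Bicategory.Strict.associator_eqToIso]

lemma whisker_assoc' {a b c d : D} (f : a ⟶ b) {g g' : b ⟶ c} (η : g ⟶ g') (h : c ⟶ d) :
    (f ◁ η) ▷ h = eqToHom (Bicategory.Strict.assoc f g h) ≫ f ◁ η ▷ h ≫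
      eqToHom (Bicategory.Strict.assoc f g' h).symm := by
  simp [Bicategory.Strict.associator_eqToIso]

lemma postcomp_id (K X : D) : postcomp K (𝟙 X) = 𝟭 (K ⟶ X) :=
  _root_.CategoryTheory.Functor.ext (fun f => Bicategory.Strict.comp_id f)
    fun _ _ η => whiskerRight_id' η

lemma postcomp_comp (K : D) {X Y Z : D} (f : X ⟶ Y) (g : Y ⟶ Z) :
    postcomp K (f ≫ g) = postcomp K f ⋙ postcomp K g :=
  _root_.CategoryTheory.Functor.ext (fun h => (Bicategory.Strict.assoc h f g).symm)
    fun _ _ η => whiskerRight_comp' η f g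

lemma precomp_id (X K : D) : precomp X (𝟙 K) = 𝟭 (K ⟶ X) :=
  _root_.CategoryTheory.Functor.ext (fun f => Bicategory.Strict.id_comp f)
    fun _ _ η => id_whiskerLeft' η

lemma precomp_comp (X : D) {a b c : D} (f : a ⟶ b) (g : b ⟶ c) :
    precomp X (f ≫ g) = precomp X g ⋙ precomp X f :=
  _root_.CategoryTheory.Functor.ext (fun h => Bicategory.Strict.assoc f g h)
    fun _ _ η => comp_whiskerLeft' f g η

lemma comp_whiskerLeft'' {a b c d : D} (f : a ⟶ b) (g : b ⟶ c) {h h' : c ⟶ d} (η : h ⟶ h') :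
    f ◁ g ◁ η = eqToHom (Bicategory.Strict.assoc f g h).symm ≫ (f ≫ g) ◁ η ≫
      eqToHom (Bicategory.Strict.assoc f g h') := by
  simp [Bicategory.Strict.associator_eqToIso]

lemma whiskerRight_comp'' {a b c d : D} {f f' : a ⟶ b} (η : f ⟶ f') (g : b ⟶ c) (h : c ⟶ d) :
    η ▷ g ▷ h = eqToHom (Bicategory.Strict.assoc f g h) ≫ η ▷ (g ≫ h) ≫
      eqToHom (Bicategory.Strict.assoc f' g h).symm := by
  simp [Bicategory.Strict.associator_eqToIso]

lemma whisker_assoc'' {a b c d : D} (f : a ⟶ b) {g g' : b ⟶ c} (η : g ⟶ g') (h : c ⟶ d) :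
    f ◁ η ▷ h = eqToHom (Bicategory.Strict.assoc f g h).symm ≫ (f ◁ η) ▷ h ≫
      eqToHom (Bicategory.Strict.assoc f g' h) := by
  simp [Bicategory.Strict.associator_eqToIso]

/-- The covariant representable `2`-functor `D(K, -) : D ⥤ Cat`. -/
def homFrom (K : D) : StrictPseudofunctor D Cat.{w, v} := StrictPseudofunctor.mk''
  { obj := fun X => Cat.of (K ⟶ X)
    map := fun h => (postcomp K h).toCatHom
    map₂ := fun b => ((postcomposing K _ _).map b).toCatHom₂
    map₂_id := fun h => by
      ext x : 3
      exact whiskerLeft_id x h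
    map₂_comp := fun b b' => by
      ext x : 3
      exact whiskerLeft_comp x b b'
    map_id := fun X => congrArg Functor.toCatHom (postcomp_id K X)
    map_comp := fun f g => congrArg Functor.toCatHom (postcomp_comp K f g)
    map₂_whisker_left := fun f _ _ η => by
      ext x : 3
      simp only [Cat.Hom₂.comp_app, Cat.eqToHom_app]
      exact comp_whiskerLeft'' x f η
    map₂_whisker_right := fun η g => by
      ext x : 3
      simp only [Cat.Hom₂.comp_app, Cat.eqToHom_app]
      exact whisker_assoc'' x η g }

/-- The `0`-cell `K` represents the `2`-functor `G : D ⥤ Cat`: there is a `2`-natural isomorphism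
`D(K, -) ≅ G`. -/
def Represents (G : StrictPseudofunctor D Cat.{v₂, u₂}) (K : D) : Prop :=
  Nonempty (TwoNatIso (homFrom K) G)

end Representable

/-! ### Weighted colimits -/

section WeightedColimit

variable {I : Type u₁} [Bicategory.{w₁, v₁} I] [Bicategory.Strict I]
  {D : Type u} [Bicategory.{w, v} D] [Bicategory.Strict D]

lemma map₂_whiskerRight_whiskerRight (T : StrictPseudofunctor I D) {X : D} {i j k : I}
    {f f' : i ⟶ j} (η : f ⟶ f') (g : j ⟶ k) (x : T.obj k ⟶ X) :
    T.map₂ (η ▷ g) ▷ x =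
      eqToHom (by rw [T.map_comp, Bicategory.Strict.assoc]) ≫ T.map₂ η ▷ (T.map g ≫ x) ≫
        eqToHom (by rw [T.map_comp, Bicategory.Strict.assoc]) := by
  rw [T.map₂_whisker_right, T.mapComp_eq_eqToIso, T.mapComp_eq_eqToIso]
  simp [Bicategory.Strict.associator_eqToIso]

lemma map₂_whiskerLeft_whiskerRight (T : StrictPseudofunctor I D) {X : D} {i j k : I}
    (f : i ⟶ j) {g g' : j ⟶ k} (η : g ⟶ g') (x : T.obj k ⟶ X) :
    T.map₂ (f ◁ η) ▷ x =
      eqToHom (by rw [T.map_comp, Bicategory.Strict.assoc]) ≫ T.map f ◁ T.map₂ η ▷ x ≫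
        eqToHom (by rw [T.map_comp, Bicategory.Strict.assoc]) := by
  rw [T.map₂_whisker_left, T.mapComp_eq_eqToIso, T.mapComp_eq_eqToIso]
  simp [Bicategory.Strict.associator_eqToIso]

/-- The `2`-functor `D(𝐓(-), X) : Iᵒᵖ ⥤ Cat` of "homming out of" `𝐓 : I ⥤ D`. -/
def homOut (T : StrictPseudofunctor I D) (X : D) : StrictPseudofunctor Iᵒᵖ Cat.{w, v} :=
  StrictPseudofunctor.mk''
  { obj := fun i => Cat.of (T.obj i.unop ⟶ X)
    map := fun f => (precomp X (T.map f.unop)).toCatHom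
    map₂ := fun a => ((precomposing _ _ X).map (T.map₂ a.unop2)).toCatHom₂
    map₂_id := fun f => by
      ext x : 3
      change T.map₂ (𝟙 f.unop) ▷ x = 𝟙 _
      rw [T.map₂_id]
      exact id_whiskerRight _ x
    map₂_comp := fun a b => by
      ext x : 3
      change T.map₂ (a.unop2 ≫ b.unop2) ▷ x = T.map₂ a.unop2 ▷ x ≫ T.map₂ b.unop2 ▷ x
      rw [T.map₂_comp]
      exact comp_whiskerRight _ _ x
    map_id := fun i => congrArg Functor.toCatHom (by
      change precomp X (T.map (𝟙 i.unop)) = _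
      rw [T.map_id]
      exact precomp_id X _)
    map_comp := fun f g => congrArg Functor.toCatHom (by
      change precomp X (T.map (g.unop ≫ f.unop)) = _
      rw [T.map_comp]
      exact precomp_comp X _ _)
    map₂_whisker_left := fun f g g' η => by
      ext x : 3
      simp only [Cat.Hom₂.comp_app, Cat.eqToHom_app]
      exact map₂_whiskerRight_whiskerRight T η.unop2 f.unop x
    map₂_whisker_right := fun η g => by
      ext x : 3
      simp only [Cat.Hom₂.comp_app, Cat.eqToHom_app]
      exact map₂_whiskerLeft_whiskerRight T g.unop η.unop2 x }

/-- The category of `W`-weighted cocones under `𝐓` with vertex `X`: the `2`-natural transformations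
`W ⟶ D(𝐓(-), X)` and their modifications. -/
abbrev Cocone (W : StrictPseudofunctor Iᵒᵖ Cat.{v₂, u₂}) (T : StrictPseudofunctor I D) (X : D) :=
  TwoNatTrans W (homOut T X)

section

variable {W : StrictPseudofunctor Iᵒᵖ Cat.{v₂, u₂}} {T : StrictPseudofunctor I D}

lemma precomp_postcomp {a b X Y : D} (f : a ⟶ b) (h : X ⟶ Y) :
    precomp X f ⋙ postcomp a h = postcomp b h ⋙ precomp Y f :=
  _root_.CategoryTheory.Functor.ext (fun x => Bicategory.Strict.assoc f x h)
    fun _ _ η => whisker_assoc' f η h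

lemma whiskerRight_of_eq {a b X Y : D} {p p' : a ⟶ b} (t : p ⟶ p') (y : b ⟶ X) (h : X ⟶ Y)
    {q q' : a ⟶ X} (s : q ⟶ q') (e : q = p ≫ y) (e' : p' ≫ y = q')
    (hs : s = eqToHom e ≫ t ▷ y ≫ eqToHom e') :
    s ▷ h = eqToHom (by rw [e, Bicategory.Strict.assoc]) ≫ t ▷ (y ≫ h) ≫
      eqToHom (by rw [← e', Bicategory.Strict.assoc]) := by
  subst e e' hs
  simp [Bicategory.Strict.associator_eqToIso]

lemma whiskerRight_of_eq' {a b X Y : D} (p : a ⟶ b) {y y' : b ⟶ X} (t : y ⟶ y') (h : X ⟶ Y)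
    {q q' : a ⟶ X} (s : q ⟶ q') (e : q = p ≫ y) (e' : p ≫ y' = q')
    (hs : s = eqToHom e ≫ p ◁ t ≫ eqToHom e') :
    s ▷ h = eqToHom (by rw [e, Bicategory.Strict.assoc]) ≫ p ◁ (t ▷ h) ≫
      eqToHom (by rw [← e', Bicategory.Strict.assoc]) := by
  subst e e' hs
  simp [Bicategory.Strict.associator_eqToIso]

lemma whiskerLeft_of_eq {a b X Y : D} (p : a ⟶ b) (y : b ⟶ X) {h h' : X ⟶ Y} (t : h ⟶ h')
    {q : a ⟶ X} (e : q = p ≫ y) :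
    q ◁ t = eqToHom (by rw [e, Bicategory.Strict.assoc]) ≫ p ◁ (y ◁ t) ≫
      eqToHom (by rw [e, Bicategory.Strict.assoc]) := by
  subst e
  exact comp_whiskerLeft' p y t

/-- The composite of a cocone with vertex `X` and a `1`-cell `X ⟶ Y`. -/
def Cocone.post {X Y : D} (h : X ⟶ Y) (l : Cocone W T X) : Cocone W T Y where
  app i := l.app i ⋙ postcomp (T.obj i.unop) h
  naturality {i j} f := by
    have e₁ := l.naturality f
    have e₂ := precomp_postcomp (T.map f.unop) h
    exact (congrArg (· ⋙ postcomp (T.obj j.unop) h) e₁).trans (congrArg (l.app i ⋙ ·) e₂)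
  naturality₂ {i j f g} α x := by
    exact whiskerRight_of_eq (T.map₂ α.unop2) ((l.app i).obj x) h _ _ _ (l.naturality₂ α x)

/-- The composite of a modification of cocones with vertex `X` and a `1`-cell `X ⟶ Y`. -/
def Cocone.postMap {X Y : D} (h : X ⟶ Y) {l l' : Cocone W T X} (m : l ⟶ l') :
    Cocone.post h l ⟶ Cocone.post h l' where
  app i := Functor.whiskerRight (m.app i) (postcomp (T.obj i.unop) h)
  naturality {i j} f x := by
    exact whiskerRight_of_eq' (T.map f.unop) ((m.app i).app x) h _ _ _ (m.naturality f x)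

/-- The functor of composition with a `1`-cell `X ⟶ Y`. -/
def Cocone.postFunctor (W : StrictPseudofunctor Iᵒᵖ Cat.{v₂, u₂}) (T : StrictPseudofunctor I D)
    {X Y : D} (h : X ⟶ Y) : Cocone W T X ⥤ Cocone W T Y where
  obj := Cocone.post h
  map := Cocone.postMap h
  map_id l := by
    apply TwoNatTrans.hom_ext
    intro i x
    exact id_whiskerRight _ h
  map_comp m m' := by
    apply TwoNatTrans.hom_ext
    intro i x
    exact comp_whiskerRight _ _ h

/-- The natural transformation of composition with a `2`-cell. -/
def Cocone.postTrans (W : StrictPseudofunctor Iᵒᵖ Cat.{v₂, u₂}) (T : StrictPseudofunctor I D)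
    {X Y : D} {h h' : X ⟶ Y} (b : h ⟶ h') :
    Cocone.postFunctor W T h ⟶ Cocone.postFunctor W T h' where
  app l :=
    { app := fun i => Functor.whiskerLeft (l.app i) ((postcomposing (T.obj i.unop) X Y).map b)
      naturality := fun {i j} f x =>
        whiskerLeft_of_eq (T.map f.unop) ((l.app i).obj x) b
          (Functor.congr_obj (l.naturality f) x) }
  naturality l l' m := by
    apply TwoNatTrans.hom_ext
    intro i x
    exact (whisker_exchange ((m.app i).app x) b).symm

lemma Cocone.post_id {X : D} (l : Cocone W T X) : Cocone.post (𝟙 X) l = l :=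
  TwoNatTrans.ext' fun i => congrArg (l.app i ⋙ ·) (postcomp_id (T.obj i.unop) X)

lemma Cocone.post_comp {X Y Z : D} (f : X ⟶ Y) (g : Y ⟶ Z) (l : Cocone W T X) :
    Cocone.post (f ≫ g) l = Cocone.post g (Cocone.post f l) :=
  TwoNatTrans.ext' fun i => congrArg (l.app i ⋙ ·) (postcomp_comp (T.obj i.unop) f g)

lemma Cocone.postFunctor_id (X : D) : Cocone.postFunctor W T (𝟙 X) = 𝟭 _ :=
  _root_.CategoryTheory.Functor.ext (fun l => Cocone.post_id l) fun _ _ m =>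
    TwoNatTrans.eq_conj _ _ _ _ fun i x => whiskerRight_id' ((m.app i).app x)

lemma Cocone.postFunctor_comp {X Y Z : D} (f : X ⟶ Y) (g : Y ⟶ Z) :
    Cocone.postFunctor W T (f ≫ g) = Cocone.postFunctor W T f ⋙ Cocone.postFunctor W T g :=
  _root_.CategoryTheory.Functor.ext (fun l => Cocone.post_comp f g l) fun _ _ m =>
    TwoNatTrans.eq_conj _ _ _ _ fun i x => whiskerRight_comp' ((m.app i).app x) f g

end

/-- The `2`-functor `X ↦ Cocone W 𝐓 X`; on `1`- and `2`-cells it is given by composition. -/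
def coconeFunctor (W : StrictPseudofunctor Iᵒᵖ Cat.{v₂, u₂}) (T : StrictPseudofunctor I D) :
    StrictPseudofunctor D Cat.{max u₁ u₂ w, max u₁ u₂ v₂ w v} := StrictPseudofunctor.mk''
  { obj := fun X => Cat.of (Cocone W T X)
    map := fun h => (Cocone.postFunctor W T h).toCatHom
    map₂ := fun b => (Cocone.postTrans W T b).toCatHom₂
    map₂_id := fun h => by
      ext l : 3
      apply TwoNatTrans.hom_ext
      intro i x
      exact whiskerLeft_id _ h
    map₂_comp := fun b b' => by
      ext l : 3
      apply TwoNatTrans.hom_ext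
      intro i x
      exact whiskerLeft_comp _ b b'
    map_id := fun X => congrArg Functor.toCatHom (Cocone.postFunctor_id X)
    map_comp := fun f g => congrArg Functor.toCatHom (Cocone.postFunctor_comp f g)
    map₂_whisker_left := fun f _ _ η => by
      ext l : 3
      simp only [Cat.Hom₂.comp_app, Cat.eqToHom_app]
      exact TwoNatTrans.eq_conj _ _ _ _ fun i x => comp_whiskerLeft'' ((l.app i).obj x) f η
    map₂_whisker_right := fun η g => by
      ext l : 3
      simp only [Cat.Hom₂.comp_app, Cat.eqToHom_app]
      exact TwoNatTrans.eq_conj _ _ _ _ fun i x => whisker_assoc'' ((l.app i).obj x) η g }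

/-- `L` is a colimit of `𝐓` weighted by `W`: it represents the `2`-functor of `W`-weighted
cocones. -/
def IsWeightedColimit (W : StrictPseudofunctor Iᵒᵖ Cat.{v₂, u₂}) (T : StrictPseudofunctor I D)
    (L : D) : Prop :=
  Represents (coconeFunctor W T) L

end WeightedColimit

/-! ### Monads in a `2`-category and Kleisli objects -/

/-- A monad `(C, T, η, μ)` in a `2`-category. In Mathlib's diagrammatic order `T ≫ T` is `T ∘ T`,
`η ▷ T` is `T η` and `T ◁ η` is `η_T`. -/
structure TwoMonad (D : Type u) [Bicategory.{w, v} D] where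
  obj : D
  T : obj ⟶ obj
  η : 𝟙 obj ⟶ T
  μ : T ≫ T ⟶ T
  unit_left : η ▷ T ≫ μ = (λ_ T).hom
  unit_right : T ◁ η ≫ μ = (ρ_ T).hom
  assoc : μ ▷ T ≫ μ = (α_ T T T).hom ≫ T ◁ μ ≫ μ

section Kleisli

variable {D : Type u} [Bicategory.{w, v} D]

/-- The identity monad `ι(X)` on a `0`-cell `X`. -/
abbrev idMonad (X : D) : TwoMonad D where
  obj := X
  T := 𝟙 X
  η := 𝟙 (𝟙 X)
  μ := (λ_ (𝟙 X)).hom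
  unit_left := by simp
  unit_right := by simp [unitors_equal]
  assoc := by simp [unitors_equal]

/-- Colax morphisms of monads from `M = (C, T)` to `N = (X, S)`: a `1`-cell `F : C ⟶ X` and a
`2`-cell `φ : F ∘ T ⟶ S ∘ F` compatible with the units and the multiplications. These are the lax
morphisms of monads in the `1`-cell dual of `D`, with the direction reversed. -/
structure ColaxHom (M N : TwoMonad D) where
  F : M.obj ⟶ N.obj
  φ : M.T ≫ F ⟶ F ≫ N.T
  unit : M.η ▷ F ≫ φ = (λ_ F).hom ≫ (ρ_ F).inv ≫ F ◁ N.η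
  mult : M.μ ▷ F ≫ φ =
    (α_ M.T M.T F).hom ≫ M.T ◁ φ ≫ (α_ M.T F N.T).inv ≫ φ ▷ N.T ≫ (α_ F N.T N.T).hom ≫ F ◁ N.μ

namespace ColaxHom

variable {M N P : TwoMonad D}

/-- Transformations between colax morphisms of monads. -/
@[ext]
structure Trans (f g : ColaxHom M N) where
  cell : f.F ⟶ g.F
  comm : M.T ◁ cell ≫ g.φ = f.φ ≫ cell ▷ N.T

/-- The category of colax morphisms of monads from `M` to `N`. -/
instance : Category (ColaxHom M N) where
  Hom := Trans
  id f := ⟨𝟙 f.F, by simp⟩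
  comp s t := ⟨s.cell ≫ t.cell, by
    rw [whiskerLeft_comp, Category.assoc, t.comm, ← Category.assoc, s.comm, comp_whiskerRight,
      Category.assoc]⟩

@[ext] lemma hom_ext {f g : ColaxHom M N} {s t : f ⟶ g} (h : s.cell = t.cell) : s = t :=
  Trans.ext h

@[simp] lemma id_cell (f : ColaxHom M N) : Trans.cell (𝟙 f) = 𝟙 f.F := rfl

@[simp] lemma comp_cell {f g h : ColaxHom M N} (s : f ⟶ g) (t : g ⟶ h) :
    Trans.cell (s ≫ t) = s.cell ≫ t.cell := rfl

/-- Composition of colax morphisms of monads. -/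
def comp (f : ColaxHom M N) (g : ColaxHom N P) : ColaxHom M P where
  F := f.F ≫ g.F
  φ := (α_ M.T f.F g.F).inv ≫ f.φ ▷ g.F ≫ (α_ f.F N.T g.F).hom ≫ f.F ◁ g.φ ≫
    (α_ f.F g.F P.T).inv
  unit := by
    calc _ = 𝟙 _ ⊗≫ (M.η ▷ f.F ≫ f.φ) ▷ g.F ⊗≫ f.F ◁ g.φ ⊗≫ 𝟙 _ := by bicategory
      _ = 𝟙 _ ⊗≫ f.F ◁ (N.η ▷ g.F ≫ g.φ) ⊗≫ 𝟙 _ := by rw [f.unit]; bicategory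
      _ = _ := by rw [g.unit]; bicategory
  mult := by
    calc _ = 𝟙 _ ⊗≫ (M.μ ▷ f.F ≫ f.φ) ▷ g.F ⊗≫ f.F ◁ g.φ ⊗≫ 𝟙 _ := by bicategory
      _ = 𝟙 _ ⊗≫ M.T ◁ f.φ ▷ g.F ⊗≫ f.φ ▷ N.T ▷ g.F ⊗≫ f.F ◁ (N.μ ▷ g.F ≫ g.φ) ⊗≫ 𝟙 _ := by
        rw [f.mult]; bicategory
      _ = 𝟙 _ ⊗≫ M.T ◁ f.φ ▷ g.F ⊗≫ (f.φ ▷ (N.T ≫ g.F) ≫ (f.F ≫ N.T) ◁ g.φ) ⊗≫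
            f.F ◁ g.φ ▷ P.T ⊗≫ f.F ◁ g.F ◁ P.μ ⊗≫ 𝟙 _ := by
        rw [g.mult]; bicategory
      _ = _ := by
        rw [← whisker_exchange]; bicategory

/-- Composition of a transformation with a colax morphism `g`. -/
def whiskerR {f f' : ColaxHom M N} (s : f ⟶ f') (g : ColaxHom N P) :
    f.comp g ⟶ f'.comp g where
  cell := s.cell ▷ g.F
  comm := by
    simp only [comp]
    calc _ = 𝟙 _ ⊗≫ (M.T ◁ s.cell ≫ f'.φ) ▷ g.F ⊗≫ f'.F ◁ g.φ ⊗≫ 𝟙 _ := by bicategory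
      _ = 𝟙 _ ⊗≫ f.φ ▷ g.F ⊗≫ (s.cell ▷ (N.T ≫ g.F) ≫ f'.F ◁ g.φ) ⊗≫ 𝟙 _ := by
        rw [s.comm]; bicategory
      _ = _ := by
        rw [← whisker_exchange]; bicategory

/-- Composition of a colax morphism `f` with a transformation. -/
def whiskerL (f : ColaxHom M N) {g g' : ColaxHom N P} (t : g ⟶ g') :
    f.comp g ⟶ f.comp g' where
  cell := f.F ◁ t.cell
  comm := by
    simp only [comp]
    calc _ = 𝟙 _ ⊗≫ ((M.T ≫ f.F) ◁ t.cell ≫ f.φ ▷ g'.F) ⊗≫ f.F ◁ g'.φ ⊗≫ 𝟙 _ := by bicategory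
      _ = 𝟙 _ ⊗≫ f.φ ▷ g.F ⊗≫ f.F ◁ (N.T ◁ t.cell ≫ g'.φ) ⊗≫ 𝟙 _ := by
        rw [whisker_exchange]; bicategory
      _ = _ := by
        rw [t.comm]; bicategory

/-- The colax morphism `ι(h) : ι(X) ⟶ ι(Y)` between identity monads given by a `1`-cell `h`. -/
abbrev ofCell {X Y : D} (h : X ⟶ Y) : ColaxHom (idMonad X) (idMonad Y) where
  F := h
  φ := (λ_ h).hom ≫ (ρ_ h).inv
  unit := by simp [idMonad]
  mult := by simp only [idMonad]; bicategory

/-- The transformation `ι(b)` given by a `2`-cell `b`. -/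
def ofCell₂ {X Y : D} {h h' : X ⟶ Y} (b : h ⟶ h') : ofCell h ⟶ ofCell h' where
  cell := b
  comm := by simp [ofCell, idMonad]

/-- The functor "compose with `ι(h)`" between categories of colax morphisms into identity
monads. -/
def postFunctor (M : TwoMonad D) {X Y : D} (h : X ⟶ Y) :
    ColaxHom M (idMonad X) ⥤ ColaxHom M (idMonad Y) where
  obj f := f.comp (ofCell h)
  map s := whiskerR s (ofCell h)
  map_id f := hom_ext (id_whiskerRight f.F h)
  map_comp s t := hom_ext (comp_whiskerRight s.cell t.cell h)

/-- The natural transformation "compose with `ι(b)`". -/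
def postTrans (M : TwoMonad D) {X Y : D} {h h' : X ⟶ Y} (b : h ⟶ h') :
    postFunctor M h ⟶ postFunctor M h' where
  app f := whiskerL f (ofCell₂ b)
  naturality _ _ s := hom_ext (whisker_exchange s.cell b).symm

lemma ext' {f g : ColaxHom M N} (e : f.F = g.F)
    (h : f.φ = eqToHom (by rw [e]) ≫ g.φ ≫ eqToHom (by rw [e])) : f = g := by
  cases f; cases g
  dsimp only at e h
  subst e
  simp only [eqToHom_refl, Category.id_comp, Category.comp_id] at h
  subst h
  rfl

lemma eq_conj {f₁ f₂ f₃ f₄ : ColaxHom M N} (s : f₁ ⟶ f₄) (e : f₁ = f₂) (t : f₂ ⟶ f₃)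
    (e' : f₃ = f₄) (h : s.cell = eqToHom (by rw [e]) ≫ t.cell ≫ eqToHom (by rw [e'])) :
    s = eqToHom e ≫ t ≫ eqToHom e' := by
  subst e e'
  apply hom_ext
  rw [h]
  simp

lemma conj_conj {a b : D} {p q p' q' p'' q'' : a ⟶ b} (s : p ⟶ q) (e₁ : p'' = p') (e₂ : p' = p)
    (e₃ : q = q') (e₄ : q' = q'') :
    eqToHom e₁ ≫ (eqToHom e₂ ≫ s ≫ eqToHom e₃) ≫ eqToHom e₄ =
      eqToHom (e₁.trans e₂) ≫ s ≫ eqToHom (e₃.trans e₄) := by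
  simp

lemma conj_whiskerRight {a b c : D} {p q p' q' : a ⟶ b} (s : p ⟶ q) (t : p' ⟶ q') (e : p = p')
    (e' : q' = q) (hs : s = eqToHom e ≫ t ≫ eqToHom e') (k : b ⟶ c) {x y : a ⟶ c}
    (e₁ : x = p ≫ k) (e₂ : q ≫ k = y) :
    eqToHom e₁ ≫ s ▷ k ≫ eqToHom e₂ =
      eqToHom (by rw [e₁, e]) ≫ t ▷ k ≫ eqToHom (by rw [← e₂, e']) := by
  subst e e' hs
  simp

variable [Bicategory.Strict D]

lemma comp_ofCell_φ {X Y : D} (f : ColaxHom M (idMonad X)) (h : X ⟶ Y) :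
    (f.comp (ofCell h)).φ =
      eqToHom (Bicategory.Strict.assoc M.T f.F h).symm ≫ f.φ ▷ h ≫ eqToHom (by
        change (f.F ≫ 𝟙 X) ≫ h = (f.F ≫ h) ≫ 𝟙 Y
        rw [Bicategory.Strict.comp_id, Bicategory.Strict.comp_id]) := by
  simp only [comp, ofCell, idMonad, Bicategory.Strict.associator_eqToIso,
    Bicategory.Strict.leftUnitor_eqToIso, Bicategory.Strict.rightUnitor_eqToIso, eqToIso.hom,
    eqToIso.inv, whiskerLeft_eqToHom, eqToHom_trans]

lemma postFunctor_id (M : TwoMonad D) (X : D) : postFunctor M (𝟙 X) = 𝟭 _ := by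
  refine _root_.CategoryTheory.Functor.ext (fun f => ?_) fun f g s => ?_
  · refine ext' (Bicategory.Strict.comp_id f.F) ?_
    refine (comp_ofCell_φ f (𝟙 X)).trans ?_
    rw [whiskerRight_id']
    simp
    rfl
  · exact eq_conj _ _ _ _ (whiskerRight_id' s.cell)

lemma postFunctor_comp (M : TwoMonad D) {X Y Z : D} (h : X ⟶ Y) (k : Y ⟶ Z) :
    postFunctor M (h ≫ k) = postFunctor M h ⋙ postFunctor M k := by
  refine _root_.CategoryTheory.Functor.ext (fun f => ?_) fun f g s => ?_
  · refine ext' (Bicategory.Strict.assoc f.F h k).symm ?_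
    refine (comp_ofCell_φ f (h ≫ k)).trans ?_
    refine Eq.trans ?_ (congrArg (fun z => eqToHom _ ≫ z ≫ eqToHom _)
      ((comp_ofCell_φ (f.comp (ofCell h)) k).trans
        (conj_whiskerRight _ _ _ _ (comp_ofCell_φ f h) k _ _))).symm
    rw [whiskerRight_comp']
    exact (conj_conj _ _ _ _ _).trans (conj_conj _ _ _ _ _).symm
  · exact eq_conj _ _ _ _ (whiskerRight_comp' s.cell h k)

end ColaxHom

/-- The `2`-functor `X ↦ Mnd_*(M, ι(X))` of colax morphisms from the monad `M` to the identity
monads. -/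
def colaxFunctor [Bicategory.Strict D] (M : TwoMonad D) :
    StrictPseudofunctor D Cat.{w, max v w} := StrictPseudofunctor.mk''
  { obj := fun X => Cat.of (ColaxHom M (idMonad X))
    map := fun h => (ColaxHom.postFunctor M h).toCatHom
    map₂ := fun b => (ColaxHom.postTrans M b).toCatHom₂
    map₂_id := fun h => by
      ext f : 3
      exact ColaxHom.hom_ext (whiskerLeft_id _ h)
    map₂_comp := fun b b' => by
      ext f : 3
      exact ColaxHom.hom_ext (whiskerLeft_comp _ b b')
    map_id := fun X => congrArg Functor.toCatHom (ColaxHom.postFunctor_id M X)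
    map_comp := fun f g => congrArg Functor.toCatHom (ColaxHom.postFunctor_comp M f g)
    map₂_whisker_left := fun h _ _ b => by
      ext f : 3
      simp only [Cat.Hom₂.comp_app, Cat.eqToHom_app]
      exact ColaxHom.eq_conj _ _ _ _ (comp_whiskerLeft'' (ColaxHom.F f) h b)
    map₂_whisker_right := fun b h => by
      ext f : 3
      simp only [Cat.Hom₂.comp_app, Cat.eqToHom_app]
      exact ColaxHom.eq_conj _ _ _ _ (whisker_assoc'' (ColaxHom.F f) b h) }

/-- `K` is a Kleisli object of the monad `M`: it represents the `2`-functor of colax morphisms from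
`M` to the identity monads. -/
def IsKleisliObject [Bicategory.Strict D] (M : TwoMonad D) (K : D) : Prop :=
  Represents (colaxFunctor M) K

end Kleisli

/-! ### The `2`-functor corresponding to a monad -/

section MonotoneMaps

/-- The inclusion of `n` into `n + 1` as an initial segment. -/
def incl (n : ℕ) : Fin n →o Fin (n + 1) := ⟨Fin.castSucc, fun _ _ h => h⟩

/-- A monotone map into `m + 1` that misses the last element, seen as a map into `m`. -/
def lower {n m : ℕ} (f : Fin (n + 1) →o Fin (m + 1)) (h : f (Fin.last n) ≠ Fin.last m) :
    Fin (n + 1) →o Fin m where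
  toFun i := ⟨(f i).val, by
    have h₁ : (f i).val ≤ (f (Fin.last n)).val := f.monotone (Fin.le_last i)
    have h₂ : (f (Fin.last n)).val ≠ m := fun e => h (Fin.ext e)
    have := (f (Fin.last n)).isLt
    omega⟩
  monotone' _ _ hij := f.monotone hij

/-- The unique map out of the empty ordinal. -/
def fromEmpty (m : ℕ) : Fin 0 →o Fin m := ⟨Fin.elim0, fun i => i.elim0⟩

lemma incl_comp_lower {n m : ℕ} (f : Fin (n + 1) →o Fin (m + 1))
    (h : f (Fin.last n) ≠ Fin.last m) : (incl m).comp (lower f h) = f := rfl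

lemma mono_cases {n m : ℕ} (f : Fin n →o Fin (m + 1)) :
    (∃ g : Fin n →o Fin m, f = (incl m).comp g) ∨
      ∃ k, ∃ e : n = k + 1, f (Fin.cast e.symm (Fin.last k)) = Fin.last m := by
  cases n with
  | zero => exact Or.inl ⟨fromEmpty m, OrderHom.ext _ _ (funext fun i => i.elim0)⟩
  | succ n =>
    by_cases h : f (Fin.last n) = Fin.last m
    · exact Or.inr ⟨n, rfl, h⟩
    · exact Or.inl ⟨lower f h, rfl⟩

lemma mono_induction {P : ∀ n m, (Fin n →o Fin m) → Prop} (h₀ : ∀ f, P 0 0 f)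
    (h₁ : ∀ n m (f : Fin n →o Fin m), P n m f → P n (m + 1) ((incl m).comp f))
    (h₂ : ∀ n m (f : Fin (n + 1) →o Fin (m + 1)), f (Fin.last n) = Fin.last m →
      P n (m + 1) (f.comp (incl n)) → P (n + 1) (m + 1) f) :
    ∀ m n f, P n m f := by
  intro m
  induction m with
  | zero =>
    intro n f
    cases n with
    | zero => exact h₀ f
    | succ n => exact (f 0).elim0
  | succ m ihm =>
    intro n
    induction n with
    | zero =>
      intro f
      obtain ⟨g, rfl⟩ | ⟨k, e, -⟩ := mono_cases f
      · exact h₁ _ _ _ (ihm _ _)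
      · omega
    | succ n ihn =>
      intro f
      by_cases h : f (Fin.last n) = Fin.last m
      · exact h₂ _ _ _ h (ihn _)
      · exact h₁ _ _ _ (ihm _ (lower f h))

end MonotoneMaps

namespace TwoMonad

variable {D : Type u} [Bicategory.{w, v} D] (M : TwoMonad D)

/-- The power `T ^ n = T ∘ ⋯ ∘ T`. -/
def pow : ℕ → (M.obj ⟶ M.obj)
  | 0 => 𝟙 M.obj
  | n + 1 => M.T ≫ pow n

/-- The unit `Y η : Y ⟶ Y ∘ T`. -/
def unitAt (Y : M.obj ⟶ M.obj) : Y ⟶ M.T ≫ Y := (λ_ Y).inv ≫ M.η ▷ Y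

/-- The multiplication `Y μ : Y ∘ T ∘ T ⟶ Y ∘ T`. -/
def multAt (Y : M.obj ⟶ M.obj) : M.T ≫ M.T ≫ Y ⟶ M.T ≫ Y := (α_ M.T M.T Y).inv ≫ M.μ ▷ Y

lemma unitAt_naturality {Y Y' : M.obj ⟶ M.obj} (f : Y ⟶ Y') :
    f ≫ M.unitAt Y' = M.unitAt Y ≫ M.T ◁ f := by
  simp only [unitAt, Category.assoc, ← whisker_exchange, id_whiskerLeft, Iso.inv_hom_id_assoc]

lemma multAt_naturality {Y Y' : M.obj ⟶ M.obj} (f : Y ⟶ Y') :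
    M.multAt Y ≫ M.T ◁ f = M.T ◁ M.T ◁ f ≫ M.multAt Y' := by
  simp only [multAt, Category.assoc, ← whisker_exchange, comp_whiskerLeft,
    Iso.inv_hom_id_assoc]

lemma unitAt_multAt (Y : M.obj ⟶ M.obj) : M.unitAt (M.T ≫ Y) ≫ M.multAt Y = 𝟙 _ := by
  calc _ = 𝟙 _ ⊗≫ (M.η ▷ M.T ≫ M.μ) ▷ Y := by simp only [unitAt, multAt]; bicategory
    _ = _ := by rw [M.unit_left]; bicategory

lemma whiskerLeft_unitAt_multAt (Y : M.obj ⟶ M.obj) :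
    M.T ◁ M.unitAt Y ≫ M.multAt Y = 𝟙 _ := by
  calc _ = 𝟙 _ ⊗≫ (M.T ◁ M.η ≫ M.μ) ▷ Y := by simp only [unitAt, multAt]; bicategory
    _ = _ := by rw [M.unit_right]; bicategory

lemma multAt_multAt (Y : M.obj ⟶ M.obj) :
    M.T ◁ M.multAt Y ≫ M.multAt Y = M.multAt (M.T ≫ Y) ≫ M.multAt Y := by
  calc _ = 𝟙 _ ⊗≫ ((α_ M.T M.T M.T).hom ≫ M.T ◁ M.μ ≫ M.μ) ▷ Y := by
        simp only [multAt]; bicategory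
    _ = _ := by rw [← M.assoc]; simp only [multAt]; bicategory

/-- `T ^ n η : T ^ n ⟶ T ^ (n + 1)`. -/
def unitPow (n : ℕ) : M.pow n ⟶ M.pow (n + 1) := M.unitAt (M.pow n)

/-- `T ^ n μ : T ^ (n + 2) ⟶ T ^ (n + 1)`. -/
def multPow (n : ℕ) : M.pow (n + 2) ⟶ M.pow (n + 1) := M.multAt (M.pow n)

/-- The `2`-cell `x T : T ^ (n + 1) ⟶ T ^ (m + 1)` for a `2`-cell `x : T ^ n ⟶ T ^ m`. -/
def succPow {n m : ℕ} (x : M.pow n ⟶ M.pow m) : M.pow (n + 1) ⟶ M.pow (m + 1) := M.T ◁ x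

lemma succPow_comp {n m p : ℕ} (x : M.pow n ⟶ M.pow m) (y : M.pow m ⟶ M.pow p) :
    M.succPow (x ≫ y) = M.succPow x ≫ M.succPow y := whiskerLeft_comp _ _ _

lemma unitPow_naturality {n m : ℕ} (x : M.pow n ⟶ M.pow m) :
    x ≫ M.unitPow m = M.unitPow n ≫ M.succPow x := M.unitAt_naturality x

lemma multPow_naturality {n m : ℕ} (x : M.pow n ⟶ M.pow m) :
    M.multPow n ≫ M.succPow x = M.succPow (M.succPow x) ≫ M.multPow m := M.multAt_naturality x

lemma unitPow_multPow (n : ℕ) : M.unitPow (n + 1) ≫ M.multPow n = 𝟙 _ := M.unitAt_multAt _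

lemma succPow_unitPow_multPow (n : ℕ) : M.succPow (M.unitPow n) ≫ M.multPow n = 𝟙 _ :=
  M.whiskerLeft_unitAt_multAt _

lemma multPow_multPow (n : ℕ) :
    M.succPow (M.multPow n) ≫ M.multPow n = M.multPow (n + 1) ≫ M.multPow n :=
  M.multAt_multAt _

/-- The `2`-cell `𝐓(f) : T ^ n ⟶ T ^ m` for a monotone `f : n ⟶ m`. If the last element of `m` is
not a value of `f`, then `f` factors as `f' : n ⟶ m - 1` followed by the inclusion, and
`𝐓(f)` is `𝐓(f')` followed by `T ^ (m - 1) η`. Otherwise `f` maps the last element to the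
last one, and `𝐓(f)` is `𝐓(f') T` followed by `T ^ (m - 1) μ`, where `f'` is the restriction of `f`
to `n - 1`. -/
def cell : (n m : ℕ) → (Fin n →o Fin m) → (M.pow n ⟶ M.pow m)
  | 0, 0, _ => 𝟙 _
  | _ + 1, 0, f => (f 0).elim0
  | 0, m + 1, _ => cell 0 m (fromEmpty m) ≫ M.unitPow m
  | n + 1, m + 1, f =>
    if h : f (Fin.last n) = Fin.last m then
      M.succPow (cell n (m + 1) (f.comp (incl n))) ≫ M.multPow m
    else cell (n + 1) m (lower f h) ≫ M.unitPow m
  termination_by n m => n + m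

lemma cell_zero (f : Fin 0 →o Fin 0) : M.cell 0 0 f = 𝟙 _ := by
  rw [cell]

lemma cell_incl {n m : ℕ} (f : Fin n →o Fin m) :
    M.cell n (m + 1) ((incl m).comp f) = M.cell n m f ≫ M.unitPow m := by
  cases n with
  | zero =>
    rw [cell]
    congr 2
    exact OrderHom.ext _ _ (funext fun i => i.elim0)
  | succ n =>
    have h : ((incl m).comp f) (Fin.last n) ≠ Fin.last m := (Fin.castSucc_lt_last _).ne
    rw [cell, dif_neg h]
    rfl

lemma cell_last {n m : ℕ} (f : Fin (n + 1) →o Fin (m + 1)) (h : f (Fin.last n) = Fin.last m) :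
    M.cell (n + 1) (m + 1) f =
      M.succPow (M.cell n (m + 1) (f.comp (incl n))) ≫ M.multPow m := by
  rw [cell, dif_pos h]

lemma cell_id (n : ℕ) : M.cell n n OrderHom.id = 𝟙 _ := by
  induction n with
  | zero => exact M.cell_zero _
  | succ n ih =>
    rw [M.cell_last _ rfl]
    have : (OrderHom.id.comp (incl n)) = (incl n).comp OrderHom.id := rfl
    rw [this, cell_incl, ih, Category.id_comp]
    exact M.succPow_unitPow_multPow n

lemma cell_comp {m p : ℕ} (g : Fin m →o Fin p) :
    ∀ {n : ℕ} (f : Fin n →o Fin m), M.cell n p (g.comp f) = M.cell n m f ≫ M.cell m p g := by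
  refine mono_induction
    (P := fun m p g => ∀ {n : ℕ} (f : Fin n →o Fin m),
      M.cell n p (g.comp f) = M.cell n m f ≫ M.cell m p g) ?_ ?_ ?_ p m g
  · intro g n f
    cases n with
    | zero => rw [cell_zero, cell_zero, cell_zero, Category.comp_id]
    | succ n => exact (f 0).elim0
  · intro m p g ih n f
    have : ((incl p).comp g).comp f = (incl p).comp (g.comp f) := rfl
    rw [this, cell_incl, cell_incl, ih, Category.assoc]
  · intro m p g hg ih n
    have h₁ : ∀ {n : ℕ} (f : Fin n →o Fin m),
        M.cell n (p + 1) (g.comp ((incl m).comp f)) =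
          M.cell n (m + 1) ((incl m).comp f) ≫ M.cell (m + 1) (p + 1) g := by
      intro n f
      have : g.comp ((incl m).comp f) = (g.comp (incl m)).comp f := rfl
      rw [this, ih, cell_incl, M.cell_last g hg, Category.assoc, ← Category.assoc (M.unitPow _),
        ← unitPow_naturality, Category.assoc, unitPow_multPow, Category.comp_id]
    induction n with
    | zero =>
      intro f
      obtain ⟨f, rfl⟩ | ⟨k, e, -⟩ := mono_cases f
      · exact h₁ f
      · omega
    | succ n ihn =>
      intro f
      by_cases hf : f (Fin.last n) = Fin.last m
      · have h : (g.comp f) (Fin.last n) = Fin.last p := (congrArg g hf).trans hg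
        have e : (g.comp f).comp (incl n) = g.comp (f.comp (incl n)) := rfl
        rw [M.cell_last _ h, e, ihn, M.cell_last f hf, succPow_comp, Category.assoc,
          Category.assoc]
        congr 1
        rw [M.cell_last g hg, succPow_comp, Category.assoc, multPow_multPow, ← Category.assoc,
          ← multPow_naturality, Category.assoc]
      · exact h₁ (lower f hf)

lemma sumFn_val {a b c d : ℕ} (f : Fin a →o Fin c) (g : Fin b →o Fin d) (i : Fin (a + b)) :
    (Delta.sumFn f g i).val =
      if h : i.val < a then (f ⟨i.val, h⟩).val
      else c + (g ⟨i.val - a, by have := i.isLt; omega⟩).val := by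
  change (dite _ _ _ : Fin (c + d)).val = _
  by_cases h : i.val < a
  · rw [dif_pos h, dif_pos h]; rfl
  · rw [dif_neg h, dif_neg h]; rfl

lemma monoHom_ext {n m : ℕ} {f g : Fin n →o Fin m} (h : ∀ i, (f i).val = (g i).val) : f = g :=
  OrderHom.ext _ _ (funext fun i => Fin.ext (h i))

variable [Bicategory.Strict D]

lemma pow_add (g f : ℕ) : M.pow (g + f) = M.pow f ≫ M.pow g := by
  induction f with
  | zero => exact (Bicategory.Strict.id_comp _).symm
  | succ f ih =>
    change M.T ≫ M.pow (g + f) = (M.T ≫ M.pow f) ≫ M.pow g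
    rw [ih, Bicategory.Strict.assoc]

lemma whiskerLeft_conj {a b c d : D} (t : a ⟶ b) (p : b ⟶ c) {g h : c ⟶ d} (x : g ⟶ h)
    {y z : b ⟶ d} (e : y = p ≫ g) (e' : p ≫ h = z) :
    t ◁ (eqToHom e ≫ p ◁ x ≫ eqToHom e') =
      eqToHom (by rw [e, Bicategory.Strict.assoc]) ≫ (t ≫ p) ◁ x ≫
        eqToHom (by rw [← e', Bicategory.Strict.assoc]) := by
  subst e e'
  simp [Bicategory.Strict.associator_eqToIso]

lemma whiskerLeft_conj' {a b c d : D} (t : a ⟶ b) {g h : b ⟶ c} (x : g ⟶ h) (p : c ⟶ d)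
    {y z : b ⟶ d} (e : y = g ≫ p) (e' : h ≫ p = z) :
    t ◁ (eqToHom e ≫ x ▷ p ≫ eqToHom e') =
      eqToHom (by rw [e, Bicategory.Strict.assoc]) ≫ (t ◁ x) ▷ p ≫
        eqToHom (by rw [← e', Bicategory.Strict.assoc]) := by
  subst e e'
  simp [Bicategory.Strict.associator_eqToIso]

lemma conj_comp {a b c : D} (k : b ⟶ c) {p q r : a ⟶ b} (x : p ⟶ q) (y : q ⟶ r)
    {p' q' r' : a ⟶ c} (e₁ : p' = p ≫ k) (e₂ : q ≫ k = q') (e₃ : r ≫ k = r') :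
    (eqToHom e₁ ≫ x ▷ k ≫ eqToHom e₂) ≫ (eqToHom e₂.symm ≫ y ▷ k ≫ eqToHom e₃) =
      eqToHom e₁ ≫ (x ≫ y) ▷ k ≫ eqToHom e₃ := by
  subst e₁ e₂ e₃
  simp

lemma succPow_conj_left {f g h : ℕ} (x : M.pow g ⟶ M.pow h) (y : M.pow (g + f) ⟶ M.pow (h + f))
    (hy : y = eqToHom (M.pow_add g f) ≫ M.pow f ◁ x ≫ eqToHom (M.pow_add h f).symm) :
    M.succPow y = eqToHom (M.pow_add g (f + 1)) ≫ M.pow (f + 1) ◁ x ≫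
      eqToHom (M.pow_add h (f + 1)).symm := by
  subst hy
  exact whiskerLeft_conj M.T (M.pow f) x _ _

lemma cell_sum_id {g h : ℕ} (η : Fin g →o Fin h) (f : ℕ) :
    M.cell (g + f) (h + f) (Delta.sumFn η OrderHom.id) =
      eqToHom (M.pow_add g f) ≫ M.pow f ◁ M.cell g h η ≫ eqToHom (M.pow_add h f).symm := by
  induction f with
  | zero =>
    have e : (Delta.sumFn η (OrderHom.id : Fin 0 →o Fin 0)) = η := by
      apply monoHom_ext
      intro i
      rw [sumFn_val]
      exact dif_pos i.isLt
    have e₂ := id_whiskerLeft' (M.cell g h η)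
    have e₃ : M.cell (g + 0) (h + 0) (Delta.sumFn η OrderHom.id) = M.cell g h η :=
      congrArg (M.cell g h) e
    refine e₃.trans (Eq.trans ?_
      (congrArg (fun z => eqToHom (M.pow_add g 0) ≫ z ≫ eqToHom (M.pow_add h 0).symm) e₂).symm)
    exact ((ColaxHom.conj_conj _ _ _ _ _).trans (by simp)).symm
  | succ f ih =>
    have h₁ : (Delta.sumFn η (OrderHom.id : Fin (f + 1) →o Fin (f + 1))) (Fin.last (g + f)) =
        Fin.last (h + f) := by
      apply Fin.ext
      rw [sumFn_val, dif_neg (by simp)]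
      simp
    have h₂ : (Delta.sumFn η (OrderHom.id : Fin (f + 1) →o Fin (f + 1))).comp (incl (g + f)) =
        (incl (h + f)).comp (Delta.sumFn η OrderHom.id) := by
      apply monoHom_ext
      intro i
      exact (sumFn_val η (OrderHom.id : Fin (f + 1) →o Fin (f + 1)) _).trans
        (sumFn_val η (OrderHom.id : Fin f →o Fin f) i).symm
    have key := M.cell_last (n := g + f) (m := h + f)
      (Delta.sumFn (a := g) (b := f + 1) (c := h) (d := f + 1) η OrderHom.id) h₁
    rw [h₂, cell_incl, succPow_comp, Category.assoc, succPow_unitPow_multPow,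
      Category.comp_id] at key
    exact key.trans (M.succPow_conj_left _ _ ih)

lemma unitAt_comp (Y Z : M.obj ⟶ M.obj) :
    M.unitAt (Y ≫ Z) = M.unitAt Y ▷ Z ≫ (α_ _ _ _).hom := by
  simp only [unitAt]; bicategory

lemma multAt_comp (Y Z : M.obj ⟶ M.obj) :
    M.multAt (Y ≫ Z) =
      M.T ◁ (α_ _ _ _).inv ≫ (α_ _ _ _).inv ≫ M.multAt Y ▷ Z ≫ (α_ _ _ _).hom := by
  simp only [multAt]; bicategory

lemma unitAt_conj {Y Y' Z : M.obj ⟶ M.obj} (e : Y' = Y ≫ Z) :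
    M.unitAt Y' = eqToHom e ≫ M.unitAt Y ▷ Z ≫
      eqToHom (by rw [e, Bicategory.Strict.assoc]) := by
  subst e
  rw [unitAt_comp, Bicategory.Strict.associator_eqToIso]
  simp

lemma multAt_conj {Y Y' Z : M.obj ⟶ M.obj} (e : Y' = Y ≫ Z) :
    M.multAt Y' = eqToHom (by rw [e, Bicategory.Strict.assoc, Bicategory.Strict.assoc]) ≫
      M.multAt Y ▷ Z ≫ eqToHom (by rw [e, Bicategory.Strict.assoc]) := by
  subst e
  rw [multAt_comp]
  simp only [Bicategory.Strict.associator_eqToIso]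
  simp

lemma unitPow_add (h m : ℕ) :
    M.unitPow (h + m) = eqToHom (M.pow_add h m) ≫ M.unitPow m ▷ M.pow h ≫
      eqToHom (M.pow_add h (m + 1)).symm :=
  M.unitAt_conj (M.pow_add h m)

lemma multPow_add (h m : ℕ) :
    M.multPow (h + m) = eqToHom (M.pow_add h (m + 2)) ≫ M.multPow m ▷ M.pow h ≫
      eqToHom (M.pow_add h (m + 1)).symm :=
  M.multAt_conj (M.pow_add h m)

lemma succPow_conj_right {h n m : ℕ} (x : M.pow n ⟶ M.pow m) (y : M.pow (h + n) ⟶ M.pow (h + m))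
    (hy : y = eqToHom (M.pow_add h n) ≫ x ▷ M.pow h ≫ eqToHom (M.pow_add h m).symm) :
    M.succPow y = eqToHom (M.pow_add h (n + 1)) ≫ M.succPow x ▷ M.pow h ≫
      eqToHom (M.pow_add h (m + 1)).symm := by
  subst hy
  exact whiskerLeft_conj' M.T x (M.pow h) _ _

lemma cell_id_sum (h : ℕ) {n m : ℕ} (η : Fin n →o Fin m) :
    M.cell (h + n) (h + m) (Delta.sumFn OrderHom.id η) =
      eqToHom (M.pow_add h n) ≫ M.cell n m η ▷ M.pow h ≫ eqToHom (M.pow_add h m).symm := by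
  refine mono_induction (P := fun n m η =>
    M.cell (h + n) (h + m) (Delta.sumFn OrderHom.id η) =
      eqToHom (M.pow_add h n) ≫ M.cell n m η ▷ M.pow h ≫ eqToHom (M.pow_add h m).symm)
    ?_ ?_ ?_ m n η
  · intro f
    have e : Delta.sumFn (OrderHom.id : Fin h →o Fin h) f = OrderHom.id := by
      apply monoHom_ext
      intro i
      rw [sumFn_val]
      exact dif_pos i.isLt
    rw [e, cell_zero, cell_id]
    simp
  · intro n m f ih
    have e : Delta.sumFn (OrderHom.id : Fin h →o Fin h) ((incl m).comp f) =
        (incl (h + m)).comp (Delta.sumFn OrderHom.id f) := by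
      apply monoHom_ext
      intro i
      change _ = (Delta.sumFn OrderHom.id f i).val
      rw [sumFn_val, sumFn_val]
      rfl
    have key := M.cell_incl (n := h + n) (m := h + m) (Delta.sumFn OrderHom.id f)
    rw [← e, ih, unitPow_add] at key
    rw [M.cell_incl f]
    exact key.trans (conj_comp _ _ _ _ _ _)
  · intro n m f hf ih
    have h₁ : (Delta.sumFn (OrderHom.id : Fin h →o Fin h) f) (Fin.last (h + n)) =
        Fin.last (h + m) := by
      apply Fin.ext
      rw [sumFn_val, dif_neg (by simp)]
      have : (⟨(Fin.last (h + n)).val - h, by simp⟩ : Fin (n + 1)) = Fin.last n :=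
        Fin.ext (by simp)
      rw [this, hf]
      simp
    have h₂ : (Delta.sumFn (OrderHom.id : Fin h →o Fin h) f).comp (incl (h + n)) =
        Delta.sumFn OrderHom.id (f.comp (incl n)) := by
      apply monoHom_ext
      intro i
      change (Delta.sumFn OrderHom.id f (Fin.castSucc i)).val = _
      rw [sumFn_val, sumFn_val]
      rfl
    have key := M.cell_last (n := h + n) (m := h + m)
      (Delta.sumFn (a := h) (b := n + 1) (c := h) (d := m + 1) OrderHom.id f) h₁
    rw [h₂] at key
    refine key.trans ((congrArg₂ (· ≫ ·) (M.succPow_conj_right _ _ ih)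
      (M.multPow_add h m)).trans ?_)
    rw [M.cell_last f hf]
    exact conj_comp _ _ _ _ _ _

/-- The `2`-functor `𝐓 : Δ ⥤ D` corresponding to the monad `M = (C, T, η, μ)`: `𝐓(*) = C`,
`𝐓(n) = T ^ n`, and `𝐓(f)` is built from `η` and `μ` as described at `TwoMonad.cell`. -/
def toTwoFunctor : StrictPseudofunctor BDelta D := StrictPseudofunctor.mk''
  { obj := fun _ => M.obj
    map := fun n => M.pow (Delta.len n)
    map₂ := fun f => M.cell _ _ (Delta.fn f)
    map₂_id := fun _ => M.cell_id _
    map₂_comp := fun f g => M.cell_comp (Delta.fn g) (Delta.fn f)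
    map_id := fun _ => rfl
    map_comp := fun _ _ => M.pow_add _ _
    map₂_whisker_left := fun _ _ _ f => M.cell_sum_id (Delta.fn f) _
    map₂_whisker_right := fun f _ => M.cell_id_sum _ (Delta.fn f) }

/-- `𝐓(1) = T`. -/
lemma pow_one : M.pow 1 = M.T := Bicategory.Strict.comp_id M.T

/-- `𝐓(0 ⟶ 1) = η`. -/
lemma cell_zero_one (f : Fin 0 →o Fin 1) : M.cell 0 1 f = M.η ≫ eqToHom M.pow_one.symm := by
  have e : f = (incl 0).comp OrderHom.id := OrderHom.ext _ _ (funext fun i => i.elim0)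
  rw [e, cell_incl, cell_id, Category.id_comp]
  change (λ_ (𝟙 M.obj)).inv ≫ M.η ▷ 𝟙 M.obj = _
  rw [whiskerRight_id', Bicategory.Strict.leftUnitor_eqToIso]
  simp
  rfl

/-- `𝐓(2 ⟶ 1) = μ`. -/
lemma cell_two_one (f : Fin 2 →o Fin 1) :
    M.cell 2 1 f = eqToHom (by rw [← pow_one]; exact M.pow_add 1 1) ≫ M.μ ≫
      eqToHom M.pow_one.symm := by
  have e : f.comp (incl 1) = OrderHom.id := monoHom_ext fun i => by omega
  rw [M.cell_last f (Fin.ext (by omega)), e, cell_id]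
  have e₁ : M.succPow (𝟙 (M.pow 1)) = 𝟙 _ := whiskerLeft_id _ _
  rw [e₁, Category.id_comp]
  change (α_ M.T M.T (𝟙 M.obj)).inv ≫ M.μ ▷ 𝟙 M.obj = _
  rw [whiskerRight_id', Bicategory.Strict.associator_eqToIso]
  simp
  rfl

end TwoMonad

end KleisliWeight

/-! Since `BDelta` has a single `0`-cell, a `W_r`-weighted cocone with vertex `X` is one functor `A
: Π_r ⥤ D(C, X)` that is strictly equivariant for `Δ`: `A(k + n) = A(k) T ^ n`, likewise on
morphisms `g + n`, and `A(k + f)` is `𝐓(f)` whiskered with `A(k)`. As `k = 0 + k`, the objects are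
forced to be `A(k) = U T ^ k` with `U = A(0)`.

A morphism `n ⟶ m` of `Π_r` is the same as a monotone map `n ⟶ 1 + m`, with "undefined" as the new
least element; closure of the domain upwards is exactly what makes this map monotone. So `Π_r`
consists of the Kleisli maps of the monad `1 + (-)`, and each morphism is a total map into `1 + m`
followed by `! + m`, where `! : 1 ⟶ 0` is nowhere defined (`PiR.eq_totHom_comp`). Hence `A` is
determined by `U` and `ξ = A(!) : U T ⟶ U`. The object `0` is terminal in `Π_r`
(`PiR.hom_zero_ext`), and the two algebra laws for `ξ` are the images of two equalities between
morphisms into `0`.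

Conversely an algebra `(U, ξ)` gives `A(f)` as the composite `U T ^ n ⟶ U T T ^ m ⟶ U T ^ m` of `𝐓`
of the total map with `ξ` (`TwoMonad.act`). The unit law makes `A` preserve identities
(`TwoMonad.act_shift`) and the multiplication law makes it preserve composites (`TwoMonad.act_comp`,
`PiR.tot_comp`). Modifications are likewise determined by their component at `0`.

These constructions are mutually inverse on the nose and `2`-natural in `X` (`coconeColaxIso`), so
the two represented `2`-functors are isomorphic. The same `0`-cells represent both, and a Yoneda
argument shows that representing `0`-cells are isomorphic. -/

namespace KleisliWeight

/-! ### Composition and inversion of `2`-natural isomorphisms -/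

section TwoNatIso

universe v₄ u₄

variable {J : Type u₁} [Bicategory.{w₁, v₁} J]

/-- The vertical composite of `2`-natural transformations. -/
def TwoNatTrans.vcomp {F : StrictPseudofunctor J Cat.{v₂, u₂}}
    {G : StrictPseudofunctor J Cat.{v₃, u₃}} {H : StrictPseudofunctor J Cat.{v₄, u₄}}
    (s : TwoNatTrans F G) (t : TwoNatTrans G H) : TwoNatTrans F H where
  app j := s.app j ⋙ t.app j
  naturality {i j} f :=
    (congrArg (· ⋙ t.app j) (s.naturality f)).trans (congrArg (s.app i ⋙ ·) (t.naturality f))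
  naturality₂ {i j f g} α x := by
    rw [Functor.comp_map, s.naturality₂, Functor.map_comp, Functor.map_comp, t.naturality₂,
      eqToHom_map, eqToHom_map]
    simp only [Category.assoc, eqToHom_trans, eqToHom_trans_assoc]
    rfl

namespace TwoNatIso

/-- The composite of `2`-natural isomorphisms. -/
def trans {F : StrictPseudofunctor J Cat.{v₂, u₂}} {G : StrictPseudofunctor J Cat.{v₃, u₃}}
    {H : StrictPseudofunctor J Cat.{v₄, u₄}} (s : TwoNatIso F G) (t : TwoNatIso G H) :
    TwoNatIso F H where
  toTwoNatTrans := s.toTwoNatTrans.vcomp t.toTwoNatTrans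
  inv j := t.inv j ⋙ s.inv j
  app_inv j :=
    (congrArg (fun K => s.app j ⋙ K ⋙ s.inv j) (t.app_inv j)).trans (s.app_inv j)
  inv_app j :=
    (congrArg (fun K => t.inv j ⋙ K ⋙ t.app j) (s.inv_app j)).trans (t.inv_app j)

variable {F : StrictPseudofunctor J Cat.{v₂, u₂}} {G : StrictPseudofunctor J Cat.{v₃, u₃}}

/-- The naturality square of `s` is sandwiched between the inverses at `i` and `j`. Composition of
functors is associative and unital definitionally, so the three equalities chain directly. -/
lemma inv_naturality (s : TwoNatIso F G) {i j : J} (f : i ⟶ j) :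
    (G.map f).toFunctor ⋙ s.inv j = s.inv i ⋙ (F.map f).toFunctor := by
  have h₁ := congrArg (fun K => s.inv i ⋙ K ⋙ s.inv j) (s.naturality f)
  have h₂ := congrArg (fun K => (s.inv i ⋙ (F.map f).toFunctor) ⋙ K) (s.app_inv j)
  have h₃ := congrArg (fun K => K ⋙ (G.map f).toFunctor ⋙ s.inv j) (s.inv_app i)
  exact h₃.symm.trans (h₁.symm.trans h₂)

lemma app_obj_inv_obj (s : TwoNatIso F G) (j : J) (x : G.obj j) :
    (s.app j).obj ((s.inv j).obj x) = x :=
  Functor.congr_obj (s.inv_app j) x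

lemma app_obj_injective (s : TwoNatIso F G) (j : J) : Function.Injective (s.app j).obj :=
  Function.LeftInverse.injective (g := (s.inv j).obj) fun x => Functor.congr_obj (s.app_inv j) x

/-- A morphism is recovered from its image by applying `s.inv j` and conjugating with `eqToHom`s,
which can be cancelled. -/
lemma app_map_injective (s : TwoNatIso F G) (j : J) {x y : F.obj j} {f g : x ⟶ y}
    (h : (s.app j).map f = (s.app j).map g) : f = g := by
  have hf := Functor.congr_hom (s.app_inv j) f
  have hg := Functor.congr_hom (s.app_inv j) g
  rw [Functor.comp_map, h, ← Functor.comp_map, hg] at hf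
  exact (cancel_mono _).1 ((cancel_epi _).1 hf.symm)

lemma map₂_app_conj (G : StrictPseudofunctor J Cat.{v₃, u₃}) {i j : J} {f g : i ⟶ j} (α : f ⟶ g)
    {x y : G.obj i} (e : x = y) :
    (G.map₂ α).toNatTrans.app x = eqToHom (by rw [e]) ≫ (G.map₂ α).toNatTrans.app y ≫
      eqToHom (by rw [e]) := by
  subst e; simp

/-- The inverse of a `2`-natural isomorphism. -/
def symm (s : TwoNatIso F G) : TwoNatIso G F where
  app := s.inv
  naturality := s.inv_naturality
  naturality₂ {i j f g} α x := by
    -- The `2`-cell condition is tested after the faithful functor `s.app j`, where `s.naturality₂`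
    -- is available.
    apply s.app_map_injective j
    have h := Functor.congr_hom (s.inv_app j) ((G.map₂ α).toNatTrans.app x)
    rw [Functor.comp_map] at h
    rw [h, Functor.map_comp, Functor.map_comp, s.naturality₂, eqToHom_map, eqToHom_map,
      map₂_app_conj G α (s.app_obj_inv_obj i x)]
    simp
  inv := s.app
  app_inv := s.inv_app
  inv_app := s.app_inv

end TwoNatIso

/-! ### Uniqueness of representing `0`-cells. -/

variable {D : Type u} [Bicategory.{w, v} D] [Bicategory.Strict D]

lemma Represents.congr {G : StrictPseudofunctor D Cat.{v₂, u₂}}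
    {H : StrictPseudofunctor D Cat.{v₃, u₃}} (s : TwoNatIso G H) (K : D) :
    Represents G K ↔ Represents H K :=
  ⟨fun ⟨t⟩ => ⟨t.trans s⟩, fun ⟨t⟩ => ⟨t.trans s.symm⟩⟩

/-- The Yoneda argument on `1`-cells: naturality along `h`, evaluated at `𝟙 K`. -/
lemma TwoNatIso.homFrom_app_obj {K L : D} (s : TwoNatIso (homFrom K) (homFrom L)) {X : D}
    (h : K ⟶ X) : (s.app X).obj h = (s.app K).obj (𝟙 K) ≫ h := by
  have e : (s.app X).obj (𝟙 K ≫ h) = (s.app K).obj (𝟙 K) ≫ h :=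
    Functor.congr_obj (s.naturality h) (𝟙 K)
  rwa [Bicategory.Strict.id_comp] at e

lemma nonempty_iso_of_twoNatIso {K L : D} (s : TwoNatIso (homFrom K) (homFrom L)) :
    Nonempty (K ≅ L) := by
  let a : L ⟶ K := (s.app K).obj (𝟙 K)
  let b : K ⟶ L := (s.inv L).obj (𝟙 L)
  have hab : a ≫ b = 𝟙 L := (s.homFrom_app_obj b).symm.trans (s.app_obj_inv_obj L (𝟙 L))
  have hba : b ≫ a = 𝟙 K := by
    -- Injectivity reduces `b ≫ a = 𝟙 K` to the equality of images `a ≫ b ≫ a = a`, which follows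
    -- from `hab`.
    apply s.app_obj_injective K
    refine (s.homFrom_app_obj (b ≫ a)).trans ?_
    change a ≫ b ≫ a = a
    rw [← Bicategory.Strict.assoc, hab, Bicategory.Strict.id_comp]
  exact ⟨⟨b, a, hba, hab⟩⟩

/-- A `0`-cell representing a `2`-functor is unique up to isomorphism. -/
lemma Represents.nonempty_iso {G : StrictPseudofunctor D Cat.{v₂, u₂}} {K L : D}
    (hK : Represents G K) (hL : Represents G L) : Nonempty (K ≅ L) := by
  obtain ⟨s⟩ := hK
  obtain ⟨t⟩ := hL
  exact nonempty_iso_of_twoNatIso (s.trans t.symm)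

end TwoNatIso

/-! ### Morphisms of `Π_r` as monotone maps into `1 + m` -/

namespace PiR

/-- The total monotone map `n ⟶ 1 + m` of a morphism `n ⟶ m` of `Π_r`: undefined values are
replaced by the new least element. -/
def tot {n m : PiR} (f : n ⟶ m) : Fin n.len →o Fin (1 + m.len) where
  toFun i := (f.1.toFun i).elim ⟨0, by omega⟩ (Fin.natAdd 1)
  monotone' i j hij := by
    dsimp only
    cases hi : f.1.toFun i with
    | none => exact Nat.zero_le (Fin.val _)
    | some a =>
      -- The domain being closed upwards prevents a drop from a defined value back to the least
      -- element.
      obtain ⟨b, hb⟩ := Option.isSome_iff_exists.1 (f.2 i j hij (by rw [hi]; rfl))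
      rw [hb]
      exact Nat.add_le_add_left (f.1.mono i j a b hij hi hb) 1

lemma tot_val {n m : PiR} (f : n ⟶ m) (i : Fin n.len) :
    (tot f i).val = (val f i.val).elim 0 (1 + ·) := by
  rw [val, dif_pos i.isLt]
  change ((f.1.toFun i).elim _ _ : Fin (1 + m.len)).val = _
  cases f.1.toFun i <;> rfl

end PiR

/-- The inclusion of `m` into `1 + m` as a final segment. -/
def shift (m : ℕ) : Fin m →o Fin (1 + m) := ⟨Fin.natAdd 1, fun _ _ h => Nat.add_le_add_left h 1⟩

/-- The map `1 + (1 + m) ⟶ 1 + m` that identifies the two least elements. -/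
def collapse (m : ℕ) : Fin (1 + (1 + m)) →o Fin (1 + m) where
  -- Truncated subtraction sends both `0` and `1` to `0`.
  toFun i := ⟨i.val - 1, by omega⟩
  monotone' _ _ h := Nat.sub_le_sub_right h 1

/-! ### Cells of the powers of `T` induced by `shift` and `collapse`. -/

namespace TwoMonad

variable {D : Type u} [Bicategory.{w, v} D] (M : TwoMonad D)

/-- Identities of ordinals such as `0 + m = m` hold only propositionally, so rebracketing a sum
changes the type of `cell`. Comparing values makes the transport explicit. -/
lemma cell_congr {n m n' m' : ℕ} (en : n = n') (em : m = m') (f : Fin n →o Fin m)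
    (f' : Fin n' →o Fin m') (h : ∀ i, (f i).val = (f' (Fin.cast en i)).val) :
    M.cell n m f = eqToHom (by rw [en]) ≫ M.cell n' m' f' ≫ eqToHom (by rw [em]) := by
  subst en em
  obtain rfl : f = f' := monoHom_ext h
  simp

variable [Bicategory.Strict D]

lemma pow_one_add (m : ℕ) : M.pow (1 + m) = M.pow m ≫ M.T := by
  rw [pow_add, pow_one]

variable {X : D}

/-- The least element of `1 + m` is the factor `T` adjacent to `U`, the one on which `ξ` can act. -/
lemma pow_one_add_comp (m : ℕ) (U : M.obj ⟶ X) :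
    M.pow (1 + m) ≫ U = M.pow m ≫ M.T ≫ U := by
  rw [pow_one_add, Bicategory.Strict.assoc]

lemma pow_add_comp (g f : ℕ) (U : M.obj ⟶ X) :
    M.pow (g + f) ≫ U = M.pow f ≫ M.pow g ≫ U := by
  rw [pow_add, Bicategory.Strict.assoc]

variable {M}

/-- Needed because `M.pow 1 = M.T` is not definitional: `η` and `μ` agree with values of `cell` only
up to conjugation by `eqToHom`s, which have to be pulled out of whiskerings. -/
lemma whiskerLeft_whiskerRight_conj {a b c d : D} (p : a ⟶ b) {q q' r r' : b ⟶ c}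
    (x : q ⟶ q') (y : r ⟶ r') (U : c ⟶ d) (e : q = r) (e' : r' = q')
    (h : x = eqToHom e ≫ y ≫ eqToHom e') :
    (p ◁ x) ▷ U = eqToHom (by rw [e, Bicategory.Strict.assoc]) ≫ p ◁ y ▷ U ≫
      eqToHom (by rw [e', Bicategory.Strict.assoc]) := by
  subst e e' h
  simp [Bicategory.Strict.associator_eqToIso]

lemma whiskerLeft_congr {a b c : D} {p p' : a ⟶ b} (e : p = p') {q q' : b ⟶ c} (x : q ⟶ q') :
    p ◁ x = eqToHom (by rw [e]) ≫ p' ◁ x ≫ eqToHom (by rw [e]) := by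
  subst e; simp

lemma whiskerRight_congr {a b c : D} {p p' : a ⟶ b} (x : p ⟶ p') {q q' : b ⟶ c} (e : q = q') :
    x ▷ q = eqToHom (by rw [e]) ≫ x ▷ q' ≫ eqToHom (by rw [e]) := by
  subst e; simp

variable (M) in
/-- The `2`-cell `T ^ m (U η) : T ^ m U ⟶ T ^ (1 + m) U`. -/
lemma cell_shift_whiskerRight (m : ℕ) (U : M.obj ⟶ X) :
    M.cell m (1 + m) (shift m) ▷ U ≫ eqToHom (M.pow_one_add_comp m U) =
      eqToHom (by rw [Bicategory.Strict.id_comp]) ≫ M.pow m ◁ (M.η ▷ U) := by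
  -- `shift m` is the ordinal sum of `0 ⟶ 1` and the identity of `m`, so `cell_sum_id` turns its
  -- cell into a whiskering of `η`.
  have h₁ : M.cell m (1 + m) (shift m) = eqToHom (by rw [Nat.zero_add]) ≫
      M.cell (0 + m) (1 + m) (Delta.sumFn (fromEmpty 1) OrderHom.id) ≫ eqToHom rfl := by
    refine M.cell_congr (Nat.zero_add m).symm rfl _ _ fun i => ?_
    rw [sumFn_val, dif_neg (by simp)]
    change 1 + i.val = 1 + (i.val - 0)
    rw [Nat.sub_zero]
  have h₂ := whiskerLeft_whiskerRight_conj (M.pow m) (M.cell 0 1 (fromEmpty 1)) M.η U rfl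
    M.pow_one.symm ((M.cell_zero_one _).trans (Category.id_comp _).symm)
  rw [h₁, cell_sum_id]
  simp only [comp_whiskerRight, eqToHom_whiskerRight, Category.assoc, h₂, eqToHom_trans,
    eqToHom_trans_assoc, eqToHom_refl, Category.comp_id]

variable (M) in
/-- The `2`-cell `T ^ m (U μ) : T ^ (1 + (1 + m)) U ⟶ T ^ (1 + m) U`. -/
lemma cell_collapse_whiskerRight (m : ℕ) (U : M.obj ⟶ X) :
    M.cell (1 + (1 + m)) (1 + m) (collapse m) ▷ U ≫ eqToHom (M.pow_one_add_comp m U) =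
      eqToHom (by rw [pow_one_add, pow_one_add]; simp only [Bicategory.Strict.assoc]) ≫
        M.pow m ◁ (M.μ ▷ U) := by
  let c : Fin 2 →o Fin 1 := ⟨fun _ => 0, fun _ _ _ => le_rfl⟩
  -- After rebracketing its source as `2 + m`, `collapse m` is the sum of `2 ⟶ 1` and the identity
  -- of `m`.
  have h₁ : M.cell (1 + (1 + m)) (1 + m) (collapse m) = eqToHom (by rw [← Nat.add_assoc]) ≫
      M.cell (2 + m) (1 + m) (Delta.sumFn c OrderHom.id) ≫ eqToHom rfl := by
    refine M.cell_congr (Nat.add_assoc 1 1 m).symm rfl _ _ fun i => ?_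
    rw [sumFn_val]
    change i.val - 1 = dite (i.val < 2) _ _
    split_ifs with h
    · change i.val - 1 = 0
      omega
    · change i.val - 1 = 1 + (i.val - 2)
      omega
  have h₂ := whiskerLeft_whiskerRight_conj (M.pow m) (M.cell 2 1 c) M.μ U _ _ (M.cell_two_one c)
  rw [h₁, cell_sum_id]
  simp only [comp_whiskerRight, eqToHom_whiskerRight, Category.assoc, h₂, eqToHom_trans,
    eqToHom_trans_assoc, eqToHom_refl, Category.comp_id]

/-! ### The action of `Π_r` on the powers of a monad applied to an algebra -/

variable {U : M.obj ⟶ X} (ξ : M.T ≫ U ⟶ U)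

/-- The `2`-cell `T ^ n U ⟶ T ^ m U` given by a monotone map `n ⟶ 1 + m`, where `ξ` takes care of
the least element of `1 + m`. -/
def act {n m : ℕ} (t : Fin n →o Fin (1 + m)) : M.pow n ≫ U ⟶ M.pow m ≫ U :=
  M.cell n (1 + m) t ▷ U ≫ eqToHom (M.pow_one_add_comp m U) ≫ M.pow m ◁ ξ

lemma act_comp_total {n m k : ℕ} (h : Fin n →o Fin m) (t : Fin m →o Fin (1 + k)) :
    act ξ (t.comp h) = M.cell n m h ▷ U ≫ act ξ t := by
  rw [act, cell_comp, comp_whiskerRight, Category.assoc, act]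

/-- The map `shift m` misses the least element, so `ξ` only meets the factor `T` just created by
`η`, and the unit law cancels them. -/
lemma act_shift (hη : M.η ▷ U ≫ ξ = (λ_ U).hom) (m : ℕ) : act ξ (shift m) = 𝟙 _ := by
  rw [act, ← Category.assoc, cell_shift_whiskerRight, Category.assoc, ← whiskerLeft_comp, hη,
    Bicategory.Strict.leftUnitor_eqToIso]
  simp

/-- On everywhere defined morphisms the action is that of `𝐓`; this gives the `2`-cell naturality of
the cocone built from an algebra. -/
lemma act_total (hη : M.η ▷ U ≫ ξ = (λ_ U).hom) {n m : ℕ} (h : Fin n →o Fin m) :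
    act ξ ((shift m).comp h) = M.cell n m h ▷ U := by
  rw [act_comp_total, act_shift ξ hη, Category.comp_id]

/-- The right side is Kleisli composition for the monad `1 + (-)`. Interchange moves the first `ξ`
past the cell of `t`, so that `ξ` acts twice in a row. The multiplication law replaces this by `μ`
on the two least elements, which is `collapse`, followed by a single `ξ`. -/
lemma act_comp (hμ : M.μ ▷ U ≫ ξ = (α_ _ _ _).hom ≫ M.T ◁ ξ ≫ ξ) {n m k : ℕ}
    (s : Fin n →o Fin (1 + m)) (t : Fin m →o Fin (1 + k)) :
    act ξ s ≫ act ξ t =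
      act ξ ((collapse k).comp ((Delta.sumFn OrderHom.id t).comp s)) := by
  -- Adjoining a new least element to `t` amounts to whiskering its cell with one more `T` on the
  -- side of `U`.
  have h₁ : eqToHom (M.pow_one_add_comp m U) ≫ M.cell m (1 + k) t ▷ (M.T ≫ U) =
      M.cell (1 + m) (1 + (1 + k)) (Delta.sumFn OrderHom.id t) ▷ U ≫
        eqToHom (M.pow_one_add_comp (1 + k) U) := by
    rw [cell_id_sum, whiskerRight_congr _ M.pow_one]
    simp [Bicategory.Strict.associator_eqToIso]
  have h₂ : M.pow (1 + k) ◁ ξ = eqToHom (by rw [pow_one_add, Bicategory.Strict.assoc]) ≫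
      M.pow k ◁ M.T ◁ ξ ≫ eqToHom (M.pow_one_add_comp k U).symm := by
    rw [whiskerLeft_congr (M.pow_one_add k)]
    simp [Bicategory.Strict.associator_eqToIso]
  have h₃ : M.pow k ◁ M.T ◁ ξ ≫ M.pow k ◁ ξ =
      eqToHom (by rw [Bicategory.Strict.assoc]) ≫ M.pow k ◁ (M.μ ▷ U) ≫ M.pow k ◁ ξ := by
    rw [← whiskerLeft_comp, ← whiskerLeft_comp, hμ, Bicategory.Strict.associator_eqToIso]
    simp
  rw [act, act, act, cell_comp, cell_comp]
  simp only [comp_whiskerRight, Category.assoc]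
  rw [whisker_exchange_assoc, h₂, reassoc_of% h₁]
  simp only [Category.assoc, eqToHom_trans_assoc, eqToHom_refl, Category.id_comp, h₃]
  rw [← Category.assoc (M.cell (1 + (1 + k)) _ _ ▷ U), cell_collapse_whiskerRight]
  simp

/-- Adding `p` on the right leaves the least element alone, so `ξ` acts as before. The hypothesis
compares values because `1 + (m + p)` and `(1 + m) + p` are different types of targets. -/
lemma act_add {n m p : ℕ} (t : Fin n →o Fin (1 + m)) (t' : Fin (n + p) →o Fin (1 + (m + p)))
    (h : ∀ i, (t' i).val = (Delta.sumFn t (OrderHom.id : Fin p →o Fin p) i).val) :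
    act ξ t' = eqToHom (M.pow_add_comp n p U) ≫ M.pow p ◁ act ξ t ≫
      eqToHom (M.pow_add_comp m p U).symm := by
  have h₁ := M.cell_congr rfl (Nat.add_assoc 1 m p).symm t'
    (Delta.sumFn t (OrderHom.id : Fin p →o Fin p)) h
  rw [act, act, h₁, cell_sum_id, whiskerLeft_congr (M.pow_add m p)]
  simp [Bicategory.Strict.associator_eqToIso]

/-- Compatibility of the action with a `2`-cell `τ : U ⟶ V`. -/
lemma act_naturality {V : M.obj ⟶ X} (ζ : M.T ≫ V ⟶ V) (τ : U ⟶ V) (h : M.T ◁ τ ≫ ζ = ξ ≫ τ)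
    {n m : ℕ} (t : Fin n →o Fin (1 + m)) :
    act ξ t ≫ M.pow m ◁ τ = M.pow n ◁ τ ≫ act ζ t := by
  rw [act, act, whisker_exchange_assoc, Category.assoc, Category.assoc, ← whiskerLeft_comp, ← h,
    whiskerLeft_comp, whiskerLeft_congr (M.pow_one_add m) τ]
  simp [Bicategory.Strict.associator_eqToIso]

end TwoMonad

/-! ### Identities between morphisms of `Π_r` -/

namespace PiR

lemma val_comp_eqToHom {n m m' : PiR} (f : n ⟶ m) (e : m = m') (x : ℕ) :
    val (f ≫ eqToHom e) x = val f x := by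
  subst e; simp

lemma val_eqToHom_comp {n n' m : PiR} (e : n = n') (f : n' ⟶ m) (x : ℕ) :
    val (eqToHom e ≫ f) x = val f x := by
  subst e; simp

lemma tot_id (n : PiR) : tot (𝟙 n) = shift n.len := by
  apply TwoMonad.monoHom_ext
  intro i
  rw [tot_val, val_id i.isLt]
  rfl

/-- A composite can be undefined because `f` is, or because `g` is undefined at the value of `f`.
These cases produce the two least elements of `1 + (1 + k)`, and `collapse` identifies them. -/
lemma tot_comp {n m k : PiR} (f : n ⟶ m) (g : m ⟶ k) :
    tot (f ≫ g) =
      (collapse k.len).comp ((Delta.sumFn OrderHom.id (tot g)).comp (tot f)) := by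
  apply TwoMonad.monoHom_ext
  intro i
  change _ = (Delta.sumFn OrderHom.id (tot g) (tot f i)).val - 1
  have h := tot_val f i
  rw [tot_val, val_comp, TwoMonad.sumFn_val]
  cases e : val f i.val with
  | none =>
    rw [e] at h
    have h' : (tot f i).val = 0 := h
    rw [dif_pos (by omega)]
    -- Truncated subtraction keeps the least element at `0`.
    change 0 = (tot f i).val - 1
    omega
  | some y =>
    rw [e] at h
    have h' : (tot f i).val = 1 + y := h
    rw [dif_neg (by omega), tot_val]
    simp [h']

/-- Stated on values to match the hypothesis of `TwoMonad.act_add`. -/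
lemma tot_sum_id {k l : PiR} (g : k ⟶ l) (n : Delta) (i : Fin (k.len + n.len)) :
    (tot (sum g (𝟙 n)) i).val = (Delta.sumFn (tot g) (OrderHom.id : Fin n.len →o _) i).val := by
  have h := tot_val (sum g (𝟙 n)) i
  refine h.trans ?_
  rw [val_sum _ _ i.isLt, TwoMonad.sumFn_val]
  split_ifs with h₁
  · rw [tot_val]
  · rw [Delta.val_id (by omega)]
    change 1 + (l.len + _) = 1 + l.len + _
    rw [add_assoc]
    rfl

/-- A sum with an identity is everywhere defined, so it misses the new least element and factors
through `shift`, as `TwoMonad.act_total` requires. -/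
lemma tot_id_sum (k : PiR) {n m : Delta} (f : n ⟶ m) :
    tot (sum (𝟙 k) f) = (shift (k.len + m.len)).comp (Delta.sumFn OrderHom.id (Delta.fn f)) := by
  apply TwoMonad.monoHom_ext
  intro i
  change _ = 1 + (Delta.sumFn OrderHom.id (Delta.fn f) i).val
  rw [tot_val, val_sum _ _ i.isLt]
  have hi : i.val < k.len + n.len := i.isLt
  refine Eq.trans ?_ (congrArg (1 + ·) (TwoMonad.sumFn_val OrderHom.id (Delta.fn f) i).symm)
  split_ifs with h₁
  · rw [val_id h₁]
    rfl
  · rw [Delta.val, dif_pos (by omega)]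
    rfl

/-! ### The terminal object of `Π_r` and the factorisation of morphisms. -/

/-- The initial object of `Δ` as an object of `Π_r`. -/
abbrev zero : PiR := ⟨⟨0⟩⟩

lemma zero_len : zero.len = 0 := rfl

/-- The nowhere defined morphism `n ⟶ 0`. -/
def bang (n : PiR) : n ⟶ zero :=
  ⟨⟨fun _ => none, fun _ _ _ _ _ h => by cases h⟩, fun _ _ _ h => by cases h⟩

/-- With no available values, a morphism into `zero` is nowhere defined. This uniqueness is the
source of both algebra laws. -/
lemma hom_zero_ext {n : PiR} (f g : n ⟶ zero) : f = g := by
  apply hom_ext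
  intro x _
  cases e : val f x with
  | some y => exact absurd (val_lt f e) (Nat.not_lt_zero y)
  | none =>
    cases e' : val g x with
    | some y => exact absurd (val_lt g e') (Nat.not_lt_zero y)
    | none => rfl

lemma val_bang (n : PiR) (x : ℕ) : val (bang n) x = none := by
  cases e : val (bang n) x with
  | some y => exact absurd (val_lt _ e) (Nat.not_lt_zero y)
  | none => rfl

lemma zero_add (n : PiR) : add zero ⟨n.len⟩ = n := by
  rcases n with ⟨⟨n⟩⟩
  simp only [add, len, Nat.zero_add]

lemma zero_add_one_add (m : ℕ) : add zero ⟨1 + m⟩ = add (add zero ⟨1⟩) ⟨m⟩ := by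
  simp only [add, len, add_assoc]

/-- The map `PiR.tot f` as a morphism of `Δ`. -/
def totHom {n m : PiR} (f : n ⟶ m) : (⟨n.len⟩ : Delta) ⟶ ⟨1 + m.len⟩ := tot f

lemma val_totHom {n m : PiR} (f : n ⟶ m) {x : ℕ} (hx : x < n.len) :
    Delta.val (totHom f) x = (val f x).elim 0 (1 + ·) := by
  rw [Delta.val, dif_pos hx]
  exact tot_val f ⟨x, hx⟩

/-- A morphism of `Π_r` is a total map followed by one that is undefined at the least element. -/
lemma eq_totHom_comp {n m : PiR} (f : n ⟶ m) :
    f = eqToHom (zero_add n).symm ≫ sum (𝟙 zero) (totHom f) ≫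
      eqToHom (zero_add_one_add m.len) ≫
        sum (bang (add zero ⟨1⟩)) (𝟙 (⟨m.len⟩ : Delta)) ≫ eqToHom (zero_add m) := by
  apply hom_ext
  intro x hx
  -- The last factor is undefined at `0` and the predecessor elsewhere, so it undoes the shift by
  -- `1` in `tot`.
  have hb : ∀ y, y < 1 + m.len →
      val (sum (bang (add zero ⟨1⟩)) (𝟙 (⟨m.len⟩ : Delta))) y =
        if y < 1 then none else some (y - 1) := by
    intro y hy
    rw [val_sum _ _ (by simpa [add_len, zero_len] using hy), val_bang, zero_len, add_len, zero_len,
      Nat.zero_add, Nat.zero_add]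
    split_ifs with h
    · rfl
    · have h' : ¬ y < 1 := h
      rw [Delta.val_id (show y - 1 < m.len by omega)]
  rw [val_eqToHom_comp, ← Category.assoc, ← Category.assoc, val_comp_eqToHom, val_comp,
    val_comp_eqToHom, val_sum _ _ (by simpa [zero_len] using hx), if_neg (Nat.not_lt_zero x),
    zero_len, Nat.sub_zero, Nat.zero_add, Option.bind_some,
    hb _ (Delta.val_lt (totHom f) hx), val_totHom f hx]
  cases val f x with
  | none => rfl
  | some y => simp

end PiR

variable {D : Type u} [Bicategory.{w, v} D] {M : TwoMonad D} {X : D}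

/-! ### Colax morphisms into identity monads as algebras -/

namespace ColaxHom

/-- The structure `2`-cell `ξ : U T ⟶ U` of a colax morphism into an identity monad. -/
def str (f : ColaxHom M (idMonad X)) : M.T ≫ f.F ⟶ f.F := f.φ ≫ (ρ_ f.F).hom

/-- The unit and multiplication of an identity monad are an identity and a unitor, so the colax laws
reduce to the algebra laws for `str`. -/
lemma unit_str (f : ColaxHom M (idMonad X)) : M.η ▷ f.F ≫ f.str = (λ_ f.F).hom := by
  rw [str, ← Category.assoc, f.unit]
  simp

lemma mult_str (f : ColaxHom M (idMonad X)) :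
    M.μ ▷ f.F ≫ f.str = (α_ _ _ _).hom ≫ M.T ◁ f.str ≫ f.str := by
  rw [str, ← Category.assoc, f.mult]
  simp

/-- The colax morphism into the identity monad on `X` given by an algebra. -/
def ofStr (U : M.obj ⟶ X) (ξ : M.T ≫ U ⟶ U) (hη : M.η ▷ U ≫ ξ = (λ_ U).hom)
    (hμ : M.μ ▷ U ≫ ξ = (α_ _ _ _).hom ≫ M.T ◁ ξ ≫ ξ) : ColaxHom M (idMonad X) where
  F := U
  φ := ξ ≫ (ρ_ U).inv
  unit := by
    rw [← Category.assoc, hη]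
    simp
  mult := by
    rw [← Category.assoc, hμ]
    simp

lemma str_ofStr (U : M.obj ⟶ X) (ξ : M.T ≫ U ⟶ U) (hη : M.η ▷ U ≫ ξ = (λ_ U).hom)
    (hμ : M.μ ▷ U ≫ ξ = (α_ _ _ _).hom ≫ M.T ◁ ξ ≫ ξ) : (ofStr U ξ hη hμ).str = ξ := by
  simp [str, ofStr]

lemma comm_str {f g : ColaxHom M (idMonad X)} (s : f ⟶ g) :
    M.T ◁ s.cell ≫ g.str = f.str ≫ s.cell := by
  rw [str, str, ← Category.assoc, s.comm]
  simp

/-- A transformation between colax morphisms into an identity monad from its compatibility with the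
structure `2`-cells. -/
def homOfStr {f g : ColaxHom M (idMonad X)} (τ : f.F ⟶ g.F)
    (h : M.T ◁ τ ≫ g.str = f.str ≫ τ) : f ⟶ g where
  cell := τ
  comm := by
    rw [← cancel_mono (ρ_ g.F).hom]
    simpa [str] using h

lemma ext_str {f g : ColaxHom M (idMonad X)} (e : f.F = g.F)
    (h : f.str = eqToHom (by rw [e]) ≫ g.str ≫ eqToHom e.symm) : f = g := by
  cases f; cases g
  dsimp only at e
  subst e
  refine ext' rfl ?_
  simpa [str] using h

end ColaxHom

/-! ### `W_r`-weighted cocones as functors on `Π_r` -/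

variable [Bicategory.Strict D]

namespace Cocone

/-- The functor on `Π_r` underlying a `W_r`-weighted cocone. -/
def base (l : Cocone Wr M.toTwoFunctor X) : PiR ⥤ (M.obj ⟶ X) := l.app (op BDelta.star)

/-- Together with `base_map_sum_id` and `base_map_id_sum`, this is the entire naturality of a
cocone, there being only one `0`-cell in `BDelta`: the `1`-cell condition on objects and on
morphisms, and the `2`-cell condition. -/
lemma base_obj_add (l : Cocone Wr M.toTwoFunctor X) (k : PiR) (n : Delta) :
    l.base.obj (PiR.add k n) = M.pow n.len ≫ l.base.obj k :=
  Functor.congr_obj (l.naturality (i := op BDelta.star) (j := op BDelta.star) (Quiver.Hom.op n)) k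

lemma base_map_sum_id (l : Cocone Wr M.toTwoFunctor X) {k k' : PiR} (g : k ⟶ k') (n : Delta) :
    l.base.map (PiR.sum g (𝟙 n)) = eqToHom (l.base_obj_add k n) ≫ M.pow n.len ◁ l.base.map g ≫
      eqToHom (l.base_obj_add k' n).symm :=
  Functor.congr_hom (l.naturality (i := op BDelta.star) (j := op BDelta.star) (Quiver.Hom.op n)) g

lemma base_map_id_sum (l : Cocone Wr M.toTwoFunctor X) (k : PiR) {n m : Delta} (f : n ⟶ m) :
    l.base.map (PiR.sum (𝟙 k) f) = eqToHom (l.base_obj_add k n) ≫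
      M.cell n.len m.len (Delta.fn f) ▷ l.base.obj k ≫ eqToHom (l.base_obj_add k m).symm :=
  l.naturality₂ (i := op BDelta.star) (j := op BDelta.star) (f := Quiver.Hom.op n)
    (g := Quiver.Hom.op m) (Bicategory.Opposite.Hom2.op2' f) k

/-- A `W_r`-weighted cocone from a functor on `Π_r` compatible with the actions of `Δ`. -/
def ofBase (A : PiR ⥤ (M.obj ⟶ X))
    (h₁ : ∀ k n, A.obj (PiR.add k n) = M.pow n.len ≫ A.obj k)
    (h₂ : ∀ {k k' : PiR} (g : k ⟶ k') (n : Delta), A.map (PiR.sum g (𝟙 n)) =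
      eqToHom (h₁ k n) ≫ M.pow n.len ◁ A.map g ≫ eqToHom (h₁ k' n).symm)
    (h₃ : ∀ (k : PiR) {n m : Delta} (f : n ⟶ m), A.map (PiR.sum (𝟙 k) f) =
      eqToHom (h₁ k n) ≫ M.cell n.len m.len (Delta.fn f) ▷ A.obj k ≫ eqToHom (h₁ k m).symm) :
    Cocone Wr M.toTwoFunctor X where
  app _ := A
  naturality f := _root_.CategoryTheory.Functor.ext (fun k => h₁ k f.unop) fun _ _ g => h₂ g f.unop
  naturality₂ α x := h₃ x α.unop2

lemma base_ext {l l' : Cocone Wr M.toTwoFunctor X} (h : l.base = l'.base) : l = l' :=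
  TwoNatTrans.ext' fun ⟨.star⟩ => h

/-- The natural transformation underlying a modification of `W_r`-weighted cocones. -/
def baseMap {l l' : Cocone Wr M.toTwoFunctor X} (m : l ⟶ l') : l.base ⟶ l'.base :=
  m.app (op BDelta.star)

lemma baseMap_app_add {l l' : Cocone Wr M.toTwoFunctor X} (m : l ⟶ l') (k : PiR) (n : Delta) :
    (baseMap m).app (PiR.add k n) = eqToHom (l.base_obj_add k n) ≫
      M.pow n.len ◁ (baseMap m).app k ≫ eqToHom (l'.base_obj_add k n).symm :=
  m.naturality (i := op BDelta.star) (j := op BDelta.star) (Quiver.Hom.op n) k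

/-- A modification of `W_r`-weighted cocones from a natural transformation compatible with the
action of `Δ`. -/
def homOfBase {l l' : Cocone Wr M.toTwoFunctor X} (s : l.base ⟶ l'.base)
    (h : ∀ k n, s.app (PiR.add k n) = eqToHom (l.base_obj_add k n) ≫
      M.pow n.len ◁ s.app k ≫ eqToHom (l'.base_obj_add k n).symm) : l ⟶ l' where
  app := fun ⟨.star⟩ => s
  naturality {i j} f x := by
    obtain ⟨⟨⟩⟩ := i
    obtain ⟨⟨⟩⟩ := j
    exact h x f.unop

lemma baseMap_ext {l l' : Cocone Wr M.toTwoFunctor X} {m m' : l ⟶ l'}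
    (h : ∀ k, (baseMap m).app k = (baseMap m').app k) : m = m' :=
  TwoNatTrans.hom_ext fun ⟨.star⟩ k => h k

end Cocone

/-! ### From cocones to colax morphisms -/

lemma whiskerRight_conj {a b c : D} {p q p' q' : a ⟶ b} (s : p ⟶ q) (t : p' ⟶ q') (e : p = p')
    (e' : q' = q) (hs : s = eqToHom e ≫ t ≫ eqToHom e') (k : b ⟶ c) :
    s ▷ k = eqToHom (by rw [e]) ≫ t ▷ k ≫ eqToHom (by rw [e']) := by
  subst e e' hs
  simp

/-- Terminality of `zero` under a functor, in the form used for `unit_str` and `mult_str`. -/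
lemma PiR.map_eq_of_zero {C : Type u₁} [Category.{v₁} C] (A : PiR ⥤ C) {n n' : PiR} (e : n = n')
    (x : n ⟶ PiR.zero) (y : n' ⟶ PiR.zero) : A.map x = eqToHom (by rw [e]) ≫ A.map y := by
  subst e
  rw [PiR.hom_zero_ext x y, eqToHom_refl, Category.id_comp]

namespace Cocone

lemma base_obj_add_one (l : Cocone Wr M.toTwoFunctor X) (k : PiR) :
    M.T ≫ l.base.obj k = l.base.obj (PiR.add k ⟨1⟩) := by
  rw [base_obj_add, M.pow_one]

lemma base_map_sum_id_one (l : Cocone Wr M.toTwoFunctor X) {k k' : PiR} (g : k ⟶ k') :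
    M.T ◁ l.base.map g = eqToHom (l.base_obj_add_one k) ≫
      l.base.map (PiR.sum g (𝟙 (⟨1⟩ : Delta))) ≫ eqToHom (l.base_obj_add_one k').symm := by
  rw [base_map_sum_id, TwoMonad.whiskerLeft_congr M.pow_one]
  simp

/-- The `2`-cell `U T ⟶ U` of a cocone, where `U` is its value at `0`: the value at the nowhere
defined morphism `1 ⟶ 0`. -/
def str (l : Cocone Wr M.toTwoFunctor X) : M.T ≫ l.base.obj PiR.zero ⟶ l.base.obj PiR.zero :=
  eqToHom (l.base_obj_add_one PiR.zero) ≫ l.base.map (PiR.bang (PiR.add PiR.zero ⟨1⟩))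

/-- The image under `l.base` of the fact that `0 ⟶ 1 ⟶ 0` is the identity of `0`. -/
lemma unit_str (l : Cocone Wr M.toTwoFunctor X) :
    M.η ▷ l.base.obj PiR.zero ≫ l.str = (λ_ (l.base.obj PiR.zero)).hom := by
  let f : (⟨0⟩ : Delta) ⟶ ⟨1⟩ := fromEmpty 1
  have h₁ := l.base_map_id_sum PiR.zero f
  have h₂ := whiskerRight_conj (M.cell 0 1 (fromEmpty 1)) M.η rfl
    M.pow_one.symm ((M.cell_zero_one _).trans (Category.id_comp _).symm) (l.base.obj PiR.zero)
  -- By the `2`-cell naturality of the cocone, `U η` is the value of `l.base` at `0 ⟶ 1`.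
  have h₃ : M.η ▷ l.base.obj PiR.zero =
      eqToHom (show 𝟙 M.obj ≫ l.base.obj PiR.zero = l.base.obj (PiR.add PiR.zero ⟨0⟩) from
        Bicategory.Strict.id_comp _) ≫ l.base.map (PiR.sum (𝟙 PiR.zero) f) ≫
        eqToHom (l.base_obj_add_one PiR.zero).symm := by
    refine Eq.trans ?_
      (congrArg (fun z => eqToHom (Bicategory.Strict.id_comp _) ≫ z ≫
        eqToHom (l.base_obj_add_one PiR.zero).symm) (h₁.trans
          (congrArg (fun z => eqToHom _ ≫ z ≫ eqToHom _) h₂))).symm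
    simp only [Category.assoc, eqToHom_trans, eqToHom_trans_assoc, eqToHom_refl, Category.comp_id]
    exact (Category.id_comp _).symm
  have h₄ := PiR.map_eq_of_zero l.base (PiR.add_zero' PiR.zero)
    (PiR.sum (𝟙 PiR.zero) f ≫ PiR.bang (PiR.add PiR.zero ⟨1⟩)) (𝟙 PiR.zero)
  rw [h₃, str, Bicategory.Strict.leftUnitor_eqToIso]
  rw [Functor.map_comp, l.base.map_id] at h₄
  simp only [Category.assoc, eqToHom_trans_assoc, eqToHom_refl, Category.id_comp, h₄]
  simp

/-- Both sides are images of morphisms `2 ⟶ 1 ⟶ 0`. The first step is total on the left side and is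
undefined only at the least element on the right side; the composites agree because `0` is terminal.
-/
lemma mult_str (l : Cocone Wr M.toTwoFunctor X) :
    M.μ ▷ l.base.obj PiR.zero ≫ l.str = (α_ _ _ _).hom ≫ M.T ◁ l.str ≫ l.str := by
  let f : (⟨2⟩ : Delta) ⟶ ⟨1⟩ := ⟨fun _ => 0, fun _ _ _ => le_rfl⟩
  have h₁ := l.base_map_id_sum PiR.zero f
  have h₂ := whiskerRight_conj (M.cell 2 1 (Delta.fn f)) M.μ _ _ (M.cell_two_one _)
    (l.base.obj PiR.zero)
  have h₃ : M.μ ▷ l.base.obj PiR.zero =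
      eqToHom (by rw [base_obj_add]; exact congrArg (· ≫ _) (by
        rw [← M.pow_one]; exact (M.pow_add 1 1).symm)) ≫
        l.base.map (PiR.sum (𝟙 PiR.zero) f) ≫
        eqToHom (l.base_obj_add_one PiR.zero).symm := by
    rw [h₁, h₂]
    simp
  have h₄ := PiR.map_eq_of_zero l.base
    (show PiR.add PiR.zero ⟨2⟩ = PiR.add (PiR.add PiR.zero ⟨1⟩) ⟨1⟩ from rfl)
    (PiR.sum (𝟙 PiR.zero) f ≫ PiR.bang (PiR.add PiR.zero ⟨1⟩))
    (PiR.sum (PiR.bang (PiR.add PiR.zero ⟨1⟩)) (𝟙 (⟨1⟩ : Delta)) ≫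
      PiR.bang (PiR.add PiR.zero ⟨1⟩))
  rw [Functor.map_comp, Functor.map_comp] at h₄
  rw [h₃, str, Bicategory.Strict.associator_eqToIso, whiskerLeft_comp, base_map_sum_id_one]
  simp only [Category.assoc, eqToHom_trans_assoc, eqToHom_refl, Category.id_comp]
  refine (congrArg (eqToHom _ ≫ ·) h₄).trans ?_
  simp

/-- The colax morphism of a cocone. -/
def toColax (l : Cocone Wr M.toTwoFunctor X) : ColaxHom M (idMonad X) :=
  ColaxHom.ofStr (l.base.obj PiR.zero) l.str l.unit_str l.mult_str

lemma str_toColax (l : Cocone Wr M.toTwoFunctor X) : l.toColax.str = l.str :=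
  ColaxHom.str_ofStr _ _ _ _

/-- This is naturality at `1 ⟶ 0`, once the modification axiom has identified the component at `1`
with that at `0` whiskered by `T`. -/
lemma baseMap_comm_str {l l' : Cocone Wr M.toTwoFunctor X} (m : l ⟶ l') :
    M.T ◁ (baseMap m).app PiR.zero ≫ l'.str = l.str ≫ (baseMap m).app PiR.zero := by
  have h := baseMap_app_add m PiR.zero ⟨1⟩
  rw [TwoMonad.whiskerLeft_congr M.pow_one] at h
  rw [str, str, Category.assoc, (baseMap m).naturality, h]
  simp

variable (M X) in
/-- The functor from `W_r`-weighted cocones to colax morphisms. -/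
def toColaxFunctor : Cocone Wr M.toTwoFunctor X ⥤ ColaxHom M (idMonad X) where
  obj l := l.toColax
  map {l l'} m := ColaxHom.homOfStr ((baseMap m).app PiR.zero) (by
    rw [str_toColax, str_toColax]
    exact baseMap_comm_str m)
  map_id _ := ColaxHom.hom_ext rfl
  map_comp _ _ := ColaxHom.hom_ext rfl

end Cocone

lemma TwoMonad.cell_id_sum_whiskerRight (k : ℕ) {n m : ℕ} (t : Fin n →o Fin m) (U : M.obj ⟶ X) :
    M.cell (k + n) (k + m) (Delta.sumFn OrderHom.id t) ▷ U =
      eqToHom (M.pow_add_comp k n U) ≫ M.cell n m t ▷ (M.pow k ≫ U) ≫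
        eqToHom (M.pow_add_comp k m U).symm := by
  rw [cell_id_sum]
  simp [Bicategory.Strict.associator_eqToIso]

/-! ### From colax morphisms to cocones -/

namespace ColaxHom

/-- The functor `k ↦ U T ^ k` on `Π_r` given by a colax morphism `(U, ξ)`. -/
def powFunctor (f : ColaxHom M (idMonad X)) : PiR ⥤ (M.obj ⟶ X) where
  obj k := M.pow k.len ≫ f.F
  map g := TwoMonad.act f.str (PiR.tot g)
  map_id k := by rw [PiR.tot_id, TwoMonad.act_shift f.str f.unit_str]
  map_comp g h := by rw [PiR.tot_comp, TwoMonad.act_comp f.str f.mult_str]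

/-- The cocone of a colax morphism. -/
def toCocone (f : ColaxHom M (idMonad X)) : Cocone Wr M.toTwoFunctor X :=
  Cocone.ofBase f.powFunctor (fun k n => M.pow_add_comp k.len n.len f.F)
    (fun g n => TwoMonad.act_add f.str (PiR.tot g) _ (PiR.tot_sum_id g n))
    (fun k n m h => by
      refine (congrArg (TwoMonad.act f.str) (PiR.tot_id_sum k h)).trans ?_
      exact (TwoMonad.act_total f.str f.unit_str _).trans
        (TwoMonad.cell_id_sum_whiskerRight k.len (Delta.fn h) f.F))

variable (M X) in
/-- The functor from colax morphisms to `W_r`-weighted cocones. -/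
def toCoconeFunctor : ColaxHom M (idMonad X) ⥤ Cocone Wr M.toTwoFunctor X where
  obj f := f.toCocone
  map {f g} s := Cocone.homOfBase (l := f.toCocone) (l' := g.toCocone)
    { app := fun k => M.pow k.len ◁ s.cell
      naturality := fun _ _ h => TwoMonad.act_naturality f.str g.str s.cell (comm_str s) _ }
    (fun k n => by
      refine (TwoMonad.whiskerLeft_congr (M.pow_add k.len n.len) s.cell).trans ?_
      rw [comp_whiskerLeft']
      exact conj_conj _ _ _ _ _)
  map_id f := Cocone.baseMap_ext fun k => whiskerLeft_id _ _
  map_comp s t := Cocone.baseMap_ext fun k => whiskerLeft_comp _ _ _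

end ColaxHom

/-! ### The two constructions are inverse to each other -/

namespace ColaxHom

lemma act_one_zero {U : M.obj ⟶ X} (ξ : M.T ≫ U ⟶ U) (t : Fin 1 →o Fin (1 + 0)) :
    TwoMonad.act ξ t = eqToHom (by rw [M.pow_one]) ≫ ξ ≫
      eqToHom (Bicategory.Strict.id_comp U).symm := by
  -- The target `1 + 0` has one element, so `t` is the identity and only `ξ` remains of the action.
  obtain rfl : t = OrderHom.id := TwoMonad.monoHom_ext fun i => by omega
  have h₁ : M.cell 1 (1 + 0) OrderHom.id = 𝟙 _ := M.cell_id 1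
  have h₂ : M.pow 0 ◁ ξ = _ := id_whiskerLeft' ξ
  rw [TwoMonad.act, h₁, h₂, id_whiskerRight]
  refine (Category.id_comp _).trans ?_
  exact eqToHom_trans_assoc _ _ _

lemma toCocone_str (f : ColaxHom M (idMonad X)) :
    f.toCocone.str = eqToHom (congrArg (M.T ≫ ·) (Bicategory.Strict.id_comp f.F)) ≫ f.str ≫
      eqToHom (Bicategory.Strict.id_comp f.F).symm := by
  refine (congrArg (eqToHom (f.toCocone.base_obj_add_one PiR.zero) ≫ ·)
    (act_one_zero f.str (PiR.tot (PiR.bang (PiR.add PiR.zero ⟨1⟩))))).trans ?_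
  exact eqToHom_trans_assoc _ _ _

/-- The recovered `1`-cell is `T ^ 0 ≫ U = 𝟙 ≫ U`, equal to `U` by strictness, and the recovered
structure cell is the action at `1 ⟶ 0`, which is `ξ` by `act_one_zero`. -/
lemma toCocone_toColax (f : ColaxHom M (idMonad X)) : f.toCocone.toColax = f := by
  refine ext_str (Bicategory.Strict.id_comp f.F) ?_
  rw [Cocone.str_toColax]
  exact f.toCocone_str

variable (M X) in
lemma toCoconeFunctor_comp_toColaxFunctor :
    toCoconeFunctor M X ⋙ Cocone.toColaxFunctor M X = 𝟭 _ :=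
  _root_.CategoryTheory.Functor.ext (fun f => f.toCocone_toColax) fun _ _ s =>
    eq_conj _ _ _ _ (id_whiskerLeft' s.cell)

end ColaxHom

namespace Cocone

lemma base_obj_eq (l : Cocone Wr M.toTwoFunctor X) (k : PiR) :
    M.pow k.len ≫ l.base.obj PiR.zero = l.base.obj k := by
  rw [← l.base_obj_add PiR.zero ⟨k.len⟩, PiR.zero_add]

/-- A cocone is determined by its algebra. In the factorisation `PiR.eq_totHom_comp`, the total
factor is governed by `2`-cell naturality and the factor `! + m` by `1`-cell naturality applied to
`str`. -/
lemma act_str_tot (l : Cocone Wr M.toTwoFunctor X) {n m : PiR} (f : n ⟶ m) :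
    TwoMonad.act l.str (PiR.tot f) =
      eqToHom (l.base_obj_eq n) ≫ l.base.map f ≫ eqToHom (l.base_obj_eq m).symm := by
  have h₁ := l.base_map_id_sum PiR.zero (PiR.totHom f)
  have h₂ := l.base_map_sum_id (PiR.bang (PiR.add PiR.zero ⟨1⟩)) (⟨m.len⟩ : Delta)
  have h₃ : M.cell n.len (1 + m.len) (PiR.tot f) ▷ l.base.obj PiR.zero =
      eqToHom (l.base_obj_add PiR.zero ⟨n.len⟩).symm ≫
        l.base.map (PiR.sum (𝟙 PiR.zero) (PiR.totHom f)) ≫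
          eqToHom (l.base_obj_add PiR.zero ⟨1 + m.len⟩) := by
    rw [h₁]
    simp
    rfl
  -- Only the right side is factorised, since `f` also occurs in `PiR.tot f` on the left.
  conv_rhs => rw [PiR.eq_totHom_comp f]
  rw [TwoMonad.act, h₃, str, whiskerLeft_comp]
  simp only [Functor.map_comp, eqToHom_map, h₂, Category.assoc, whiskerLeft_eqToHom,
    eqToHom_trans, eqToHom_trans_assoc, eqToHom_refl, Category.comp_id]

lemma toColax_toCocone (l : Cocone Wr M.toTwoFunctor X) : l.toColax.toCocone = l := by
  refine base_ext (_root_.CategoryTheory.Functor.ext (fun k => l.base_obj_eq k) fun n m f => ?_)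
  refine Eq.trans ?_ (l.act_str_tot f)
  exact congrArg (fun ξ : M.T ≫ l.base.obj PiR.zero ⟶ l.base.obj PiR.zero =>
    TwoMonad.act ξ (PiR.tot f)) l.str_toColax

/-- A modification is determined by its component at `0`, by its compatibility with the `1`-cell `k`
and `k = 0 + k`. -/
lemma baseMap_app_eq {l l' : Cocone Wr M.toTwoFunctor X} (m : l ⟶ l') (k : PiR) :
    M.pow k.len ◁ (baseMap m).app PiR.zero =
      eqToHom (l.base_obj_eq k) ≫ (baseMap m).app k ≫ eqToHom (l'.base_obj_eq k).symm := by
  have h : ∀ {n n' : PiR} (e : n = n'), (baseMap m).app n =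
      eqToHom (by rw [e]) ≫ (baseMap m).app n' ≫ eqToHom (by rw [e]) := by
    rintro n _ rfl
    simp
  rw [h (PiR.zero_add k).symm, baseMap_app_add]
  simp

variable (M X) in
lemma toColaxFunctor_comp_toCoconeFunctor :
    toColaxFunctor M X ⋙ ColaxHom.toCoconeFunctor M X = 𝟭 _ :=
  _root_.CategoryTheory.Functor.ext (fun l => l.toColax_toCocone) fun _ _ m =>
    TwoNatTrans.eq_conj _ _ _ _ fun ⟨.star⟩ k => baseMap_app_eq m k

end Cocone

/-! ### `2`-naturality -/

lemma ColaxHom.str_comp_ofCell {Y : D} (f : ColaxHom M (idMonad X)) (h : X ⟶ Y) :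
    (f.comp (ofCell h)).str =
      eqToHom (Bicategory.Strict.assoc M.T f.F h).symm ≫ f.str ▷ h := by
  rw [str, comp_ofCell_φ, str]
  simp only [Bicategory.Strict.rightUnitor_eqToIso, eqToIso.hom, comp_whiskerRight,
    eqToHom_whiskerRight]
  exact (Category.assoc _ _ _).trans (congrArg (eqToHom _ ≫ ·) ((Category.assoc _ _ _).trans
    (congrArg (f.φ ▷ h ≫ ·) (eqToHom_trans _ _))))

lemma Cocone.str_post {Y : D} (l : Cocone Wr M.toTwoFunctor X) (h : X ⟶ Y) :
    (Cocone.post h l).str =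
      eqToHom (Bicategory.Strict.assoc M.T (l.base.obj PiR.zero) h).symm ≫ l.str ▷ h := by
  rw [str, str, comp_whiskerRight, eqToHom_whiskerRight, eqToHom_trans_assoc]
  rfl

/-- The underlying `1`-cells agree definitionally, and both structure cells are `l.str` whiskered
with `h`. -/
lemma Cocone.post_toColax {Y : D} (l : Cocone Wr M.toTwoFunctor X) (h : X ⟶ Y) :
    (Cocone.post h l).toColax = l.toColax.comp (ColaxHom.ofCell h) := by
  refine ColaxHom.ext_str rfl ?_
  rw [Cocone.str_toColax, Cocone.str_post, ColaxHom.str_comp_ofCell, Cocone.str_toColax]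
  exact ((Category.id_comp _).trans (Category.comp_id _)).symm

variable (M) in
/-- The `2`-natural isomorphism between `W_r`-weighted cocones under the `2`-functor of a monad and
colax morphisms from the monad to the identity monads. -/
def coconeColaxIso : TwoNatIso (coconeFunctor Wr M.toTwoFunctor) (colaxFunctor M) where
  app X := Cocone.toColaxFunctor M X
  naturality h := _root_.CategoryTheory.Functor.ext (fun l => Cocone.post_toColax l h)
    fun _ _ _ => ColaxHom.eq_conj _ _ _ _ ((Category.id_comp _).trans (Category.comp_id _)).symm
  -- Both sides have the same underlying `2`-cell, so the surrounding `eqToHom`s are identities.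
  naturality₂ _ _ :=
    ColaxHom.eq_conj _ _ _ _ ((Category.id_comp _).trans (Category.comp_id _)).symm
  inv X := ColaxHom.toCoconeFunctor M X
  app_inv X := Cocone.toColaxFunctor_comp_toCoconeFunctor M X
  inv_app X := ColaxHom.toCoconeFunctor_comp_toColaxFunctor M X

lemma isKleisliObject_iff (K : D) :
    IsKleisliObject M K ↔ IsWeightedColimit Wr M.toTwoFunctor K :=
  (Represents.congr (coconeColaxIso M) K).symm

end KleisliWeight

/-- Let `M = (C, T, η, μ)` be a monad in a `2`-category `D` and `𝐓 : Δ ⥤ D` the corresponding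
`2`-functor. Then `M` admits a Kleisli object iff `𝐓` has a `W_r`-weighted colimit, and any Kleisli
object of `M` is isomorphic in `D` to any `W_r`-weighted colimit of `𝐓`. -/
theorem mainTheorem2 {D : Type u} [Bicategory.{w, v} D] [Bicategory.Strict D]
    (M : KleisliWeight.TwoMonad D) :
    ((∃ K : D, KleisliWeight.IsKleisliObject M K) ↔
      ∃ L : D, KleisliWeight.IsWeightedColimit KleisliWeight.Wr M.toTwoFunctor L) ∧
    ∀ K L : D, KleisliWeight.IsKleisliObject M K →
      KleisliWeight.IsWeightedColimit KleisliWeight.Wr M.toTwoFunctor L → Nonempty (K ≅ L) :=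
  -- The same `0`-cell serves as Kleisli object and as weighted colimit, so the second claim is
  -- uniqueness of the weighted colimit.
  ⟨exists_congr fun K => KleisliWeight.isKleisliObject_iff K, fun K _ hK hL =>
    KleisliWeight.Represents.nonempty_iso ((KleisliWeight.isKleisliObject_iff K).1 hK) hL⟩
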